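/- Let $p$ be an odd prime, $\zeta_p$ a primitive $p$-th root of unity, $K=\mathbb{Q}(\zeta_p)$, $\pi=(\zeta_p-1)\mathbb{Z}[\zeta_p]$ the prime of $K$ above $p$, $v$ a primitive root modulo $p$, and $\sigma\in\mathrm{Gal}(K/\mathbb{Q})$ the automorphism with $\sigma(\zeta_p)=\zeta_p^{v}$. Let $P(\sigma)=\sum_{i=0}^{p-2}v^{-i}\sigma^i\in\mathbb{Z}[\mathrm{Gal}(K/\mathbb{Q})]$, where $v^{-i}$ denotes the integer in $\{1,\dots,p-1\}$ with $v^{-i}v^{i}\equiv 1 \bmod p$; thus $A^{P(\sigma)}=\prod_{i=0}^{p-2}\sigma^i(A)^{v^{-i}}$. Let $\Gamma$ be a subgroup of order $p$ of the ideal class group of $K$ annihilated by $\sigma-\mu$ for some $\mu\in\mathbb{F}_p^*$, with $\mu\equiv v^n \bmod p$, $1<n\le p-2$. Let $\mathfrak q$ be a prime ideal of $\mathbb{Z}[\zeta_p]$ whose class lies in $\Gamma$, and let $q$ be the rational prime under $\mathfrak q$. Let $A\in\mathbb{Z}[\zeta_p]$ be a singular integer (that is, $A$ is not a $p$-th power in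 $K$ and $A\mathbb{Z}[\zeta_p]$ is the $p$-th power of an ideal) with $A\mathbb{Z}[\zeta_p]=\mathfrak q^p$ and $A\equiv a \bmod \pi^n$ for some integer $a$ prime to $p$. Then: 1. If $q\equiv 1 \bmod p$, then $A^{P(\sigma)}\equiv\delta \bmod \pi^{2p-1}$ for some $\delta\in\{-1,1\}$. 2. There is $\delta\in\{-1,1\}$ with $\pi^{2p-1}\,\|\,A^{P(\sigma)}-\delta$ (that is, $\pi^{2p-1}$ divides $A^{P(\sigma)}-\delta$ and $\pi^{2p}$ does not) if and only if $q\equiv 1 \bmod p$ and $p^{(q-1)/p}\not\equiv 1 \bmod q$. 3. If $q\not\equiv 1 \bmod p$, then $A^{P(\sigma)}\equiv\delta \bmod \pi^{2p}$ for some $\delta\in\{-1,1\}$. -/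

import Mathlib

open NumberField
open scoped nonZeroDivisors

namespace SingularIntegers

variable {K : Type*} [Field K]

/-- `A ∈ 𝓞 K` is singular (with respect to `p`): it is not a `p`-th power in `K`, and the ideal
`A 𝓞 K` is the `p`-th power of an ideal of `𝓞 K`. -/
def IsSingular (p : ℕ) (A : 𝓞 K) : Prop :=
  (¬ ∃ β : K, β ^ p = (A : K)) ∧ ∃ 𝔞 : Ideal (𝓞 K), Ideal.span {A} = 𝔞 ^ p

variable [NumberField K]

/-- The action of an automorphism `σ` of `K` on the ideal class group of `K`. -/
noncomputable def classGroupAut (σ : K ≃ₐ[ℚ] K) : ClassGroup (𝓞 K) ≃* ClassGroup (𝓞 K) :=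
  ClassGroup.mulEquiv (RingOfIntegers.mapRingEquiv σ.toRingEquiv)

/-- `Γ` is a group of ideal classes of order `p` annihilated by `σ - μ`, that is
`σ(c) = c ^ μ` for all `c ∈ Γ`. Being of order `p`, it lies in the `p`-class group. -/
def IsEigenSubgroup (p : ℕ) (σ : K ≃ₐ[ℚ] K) (μ : (ZMod p)ˣ)
    (Γ : Subgroup (ClassGroup (𝓞 K))) : Prop :=
  Nat.card Γ = p ∧ ∀ c ∈ Γ, classGroupAut σ c = c ^ (μ : ZMod p).val

/-- `A ^ P(σ)`, where `P(σ) = ∑_{i=0}^{p-2} σ^i v^{-i} ∈ ℤ[Gal(K/ℚ)]` and where `v^{-i}` stands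
for its representative in `{1, …, p - 1}`; that is, `∏_{i=0}^{p-2} (σ^i A) ^ (v^{-i})`. -/
noncomputable def powP (p : ℕ) (σ : K ≃ₐ[ℚ] K) (v : (ZMod p)ˣ) (A : 𝓞 K) : 𝓞 K :=
  ∏ i ∈ Finset.range (p - 1), ((σ ^ i) • A) ^ ((v⁻¹ ^ i : (ZMod p)ˣ) : ZMod p).val

/-- `π ^ k` divides `x` exactly. -/
def ExactlyDivides (π : 𝓞 K) (k : ℕ) (x : 𝓞 K) : Prop :=
  π ^ k ∣ x ∧ ¬ π ^ (k + 1) ∣ x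

end SingularIntegers

/-!
Let `χ` be the inverse of the `p`-th power residue character modulo `𝔮`, `g` a Gauss sum of `χ`,
and `y = g ^ p ∈ ℤ[ζ]`. With the representatives `v^{-i} ∈ {1, …, p - 1}`, `P(σ)` is `p` times the
Stickelberger element, so Stickelberger's theorem gives `(y) = 𝔮 ^ P(σ)`, hence `A ^ P(σ)` and
`y ^ p` generate the same ideal. All conjugates of both have the same absolute value, so by
Kronecker they differ by a root of unity `± ζ ^ r`; as `A` is congruent to an integer modulo
`(ζ - 1) ^ 2`, so are both sides, which forces `r = 0`. Thus `A ^ P(σ) = ± y ^ p`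
(`eq_or_eq_neg_of_congr`), and the theorem is a statement about Gauss sums.

* `gaussSum_pow_prime_congr`: writing `χ(p) = 1 + (ζ - 1) c`, one has
  `y ≡ -1 + c (ζ - 1) ^ p` modulo `(ζ - 1) ^ (p + 1)`. Hence
  `y ^ p ≡ -1 - c (ζ - 1) ^ (2 p - 1)` modulo `(ζ - 1) ^ (2 p)` (`pow_prime_congr_of_congr`), and
  the last coefficient is divisible by `ζ - 1` exactly when `χ(p) = 1`, that is, when `p` is a
  `p`-th power modulo `𝔮`.
* `prime_pow_sub_one_mem_iff`: if `q ≡ 1 mod p`, the residue field of `𝔮` is `𝔽_q`, and `χ(p) = 1`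
  means `p ^ ((q - 1) / p) ≡ 1 mod q`; otherwise all of `𝔽_q` consists of `p`-th powers in the
  residue field, so `χ(p) = 1`.
* `valuation_gaussSum`: Stickelberger's theorem in the form of digit sums, for a valuation on a
  ring with enough roots of unity. Together with the description of the decomposition group of `𝔮`
  as the group generated by the class of `q`, it yields `associated_prod_pow`.
-/

namespace SingularIntegers

/-! ### Digit sums -/

theorem sum_digits_add_mul {q : ℕ} (hq : 1 < q) (m : ℕ) {r : ℕ} (hr : r < q) :
    (Nat.digits q (r + q * m)).sum = r + (Nat.digits q m).sum := by
  by_cases h : r ≠ 0 ∨ m ≠ 0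
  · rw [Nat.digits_add q hq r m hr h, List.sum_cons]
  · push Not at h
    simp [h.1, h.2]

theorem sum_digits_complement {q : ℕ} (hq : 1 < q) (f : ℕ) :
    ∀ k < q ^ f, (Nat.digits q k).sum + (Nat.digits q (q ^ f - 1 - k)).sum = f * (q - 1) := by
  induction f with
  | zero => intro k hk; simp at hk; simp [hk]
  | succ f ih =>
    intro k hk
    have h1 : k / q < q ^ f := by
      rw [Nat.div_lt_iff_lt_mul (by omega), ← pow_succ]; exact hk
    have h2 : k % q < q := Nat.mod_lt _ (by omega)
    have h3 := Nat.mod_add_div k q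
    have h4 := ih _ h1
    have h5 : q ^ (f + 1) - 1 - k = (q - 1 - k % q) + q * (q ^ f - 1 - k / q) := by
      obtain ⟨t, ht⟩ : ∃ t, q ^ f = k / q + 1 + t := ⟨q ^ f - (k / q + 1), by omega⟩
      have e : q ^ (f + 1) = q * (k / q) + q + q * t := by rw [pow_succ, ht]; ring
      rw [show q ^ f - 1 - k / q = t by omega]
      omega
    rw [h5, sum_digits_add_mul hq _ (by omega)]
    nth_rw 1 [← h3]
    rw [sum_digits_add_mul hq _ h2, add_mul, ← h4]
    omega

/-- Long division of `b / p` in base `q`: the digits `d` satisfy `q r = p d + r'`, where `r`, `r'`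
are successive remainders, and these relations telescope. -/
theorem sum_digits_long_division {q p b : ℕ} (hq : 1 < q) (hp : 0 < p) (hb : b < p) (j : ℕ) :
    p * (Nat.digits q (b * q ^ j / p)).sum + ∑ i ∈ Finset.range j, b * q ^ (i + 1) % p
      = q * ∑ i ∈ Finset.range j, b * q ^ i % p := by
  induction j with
  | zero => simp [Nat.div_eq_of_lt hb]
  | succ j ih =>
    set m := b * q ^ j / p
    set r := b * q ^ j % p with hr
    have hrp : r < p := Nat.mod_lt _ hp
    have h1 : b * q ^ (j + 1) = q * r + p * (q * m) := by
      have := Nat.mod_add_div (b * q ^ j) p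
      rw [pow_succ, ← mul_assoc, ← this]; ring
    have h2 : b * q ^ (j + 1) / p = q * r / p + q * m := by
      rw [h1, Nat.add_mul_div_left _ _ hp]
    have h3 : b * q ^ (j + 1) % p = q * r % p := by
      rw [h1, Nat.add_mul_mod_self_left]
    have h4 : q * r / p < q := by
      rw [Nat.div_lt_iff_lt_mul hp]; exact (Nat.mul_lt_mul_left (by omega)).2 hrp
    rw [Finset.sum_range_succ, Finset.sum_range_succ, h2, sum_digits_add_mul hq _ h4, h3]
    have := Nat.mod_add_div (q * r) p
    rw [mul_add, mul_add, ← ih, ← hr]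
    omega

/-- The digit sum of `b (q ^ f - 1) / p` in base `q` in terms of the residues of `b q ^ i`. -/
theorem mul_sum_digits {q p b f E : ℕ} (hq : 1 < q) (hp : 0 < p) (hb : b < p)
    (hE : p * E = q ^ f - 1) :
    p * (Nat.digits q (b * E)).sum = (q - 1) * ∑ i ∈ Finset.range f, b * q ^ i % p := by
  have h0 : 1 ≤ q ^ f := Nat.one_le_pow _ _ (by omega)
  have h1 : b * q ^ f = b + p * (b * E) := by
    rw [mul_left_comm, hE]; zify [h0]; ring
  have h2 : b * q ^ f / p = b * E := by
    rw [h1, Nat.add_mul_div_left _ _ hp, Nat.div_eq_of_lt hb, zero_add]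
  have h3 : ∑ i ∈ Finset.range f, b * q ^ (i + 1) % p = ∑ i ∈ Finset.range f, b * q ^ i % p := by
    have e1 := Finset.sum_range_succ (fun i ↦ b * q ^ i % p) f
    have e2 := Finset.sum_range_succ' (fun i ↦ b * q ^ i % p) f
    have e3 : b * q ^ f % p = b * q ^ 0 % p := by
      rw [h1, Nat.add_mul_mod_self_left, pow_zero, mul_one]
    rw [e3] at e1
    omega
  have := sum_digits_long_division hq hp hb f
  rw [h2, h3] at this
  obtain ⟨q, rfl⟩ : ∃ q', q = q' + 1 := ⟨q - 1, by omega⟩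
  rw [add_mul, one_mul] at this
  simp only [Nat.add_sub_cancel]
  omega

/-! ### Valuations of Gauss sums -/

section Stickelberger

variable {F R : Type*} [Field F] [Fintype F] [CommRing R]

/-- The additive character `x ↦ ξ ^ Tr(x)` of a finite field of characteristic `q`, for `ξ` with
`ξ ^ q = 1`. -/
noncomputable def traceChar (q : ℕ) [Fact q.Prime] [Algebra (ZMod q) F] {ξ : R} (hξ : ξ ^ q = 1) :
    AddChar F R :=
  (AddChar.zmodChar q hξ).compAddMonoidHom (Algebra.trace (ZMod q) F).toAddMonoidHom

variable {q : ℕ} [Fact q.Prime] [Algebra (ZMod q) F]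

omit [Fintype F] in
theorem traceChar_apply {ξ : R} (hξ : ξ ^ q = 1) (x : F) :
    traceChar q hξ x = ξ ^ (Algebra.trace (ZMod q) F x).val := rfl

theorem traceChar_isPrimitive {ξ : R} (hξ : IsPrimitiveRoot ξ q) :
    (traceChar (F := F) q hξ.pow_eq_one).IsPrimitive := by
  apply AddChar.IsPrimitive.of_ne_one
  intro h
  obtain ⟨x, hx⟩ := Algebra.trace_surjective (ZMod q) F 1
  have h1 := DFunLike.congr_fun h x
  rw [traceChar_apply, hx, ZMod.val_one, pow_one, AddChar.one_apply] at h1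
  exact hξ.ne_one (Fact.out : q.Prime).one_lt h1

theorem trace_pow_char (x : F) :
    Algebra.trace (ZMod q) F (x ^ q) = Algebra.trace (ZMod q) F x := by
  have h := Algebra.trace_eq_of_algEquiv (FiniteField.frobeniusAlgEquivOfAlgebraic (ZMod q) F) x
  rwa [FiniteField.coe_frobeniusAlgEquivOfAlgebraic, ZMod.card] at h

theorem gaussSum_pow_char {ξ : R} (hξ : ξ ^ q = 1) (χ : MulChar F R) :
    gaussSum (χ ^ q) (traceChar q hξ) = gaussSum χ (traceChar q hξ) := by
  have hq := (Fact.out : q.Prime)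
  rw [gaussSum, gaussSum]
  refine Fintype.sum_bijective _
    (FiniteField.frobeniusAlgEquivOfAlgebraic (ZMod q) F).bijective _ _ fun x ↦ ?_
  rw [FiniteField.coe_frobeniusAlgEquivOfAlgebraic, ZMod.card, traceChar_apply, traceChar_apply,
    trace_pow_char, map_pow, MulChar.pow_apply' _ hq.ne_zero]

theorem sum_inv_mul_trace {f : ℕ} (hf : Fintype.card F = q ^ f) :
    ∑ x : F, x⁻¹ * algebraMap (ZMod q) F (Algebra.trace (ZMod q) F x) = -1 := by
  classical
  have hq := (Fact.out : q.Prime)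
  have hrank : Module.finrank (ZMod q) F = f := by
    have := Module.card_eq_pow_finrank (K := ZMod q) (V := F)
    rw [ZMod.card, hf] at this
    exact (Nat.pow_right_injective hq.two_le this).symm
  have hf0 : 0 < f := hrank ▸ Module.finrank_pos
  simp_rw [FiniteField.algebraMap_trace_eq_sum_pow, hrank, Finset.mul_sum]
  rw [Finset.sum_comm, Finset.sum_eq_single_of_mem 0 (Finset.mem_range.2 hf0)]
  · simp only [pow_zero, pow_one]
    have : ∀ x : F, x⁻¹ * x = if x = 0 then 0 else 1 := by
      intro x; split_ifs with h
      · simp [h]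
      · exact inv_mul_cancel₀ h
    simp_rw [this]
    rw [Finset.sum_ite, Finset.sum_const_zero, zero_add, Finset.sum_const, Finset.filter_ne',
      Finset.card_erase_of_mem (Finset.mem_univ _), Finset.card_univ, nsmul_one,
      Nat.cast_sub Fintype.card_pos, FiniteField.cast_card_eq_zero]
    simp
  · intro i hi hi0
    have hpos : 1 < q ^ i := Nat.one_lt_pow hi0 hq.one_lt
    have hlt : q ^ i < q ^ f := Nat.pow_lt_pow_right hq.one_lt (Finset.mem_range.1 hi)
    rw [← FiniteField.sum_pow_lt_card_sub_one (K := F) (q ^ i - 1) (by omega)]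
    refine Finset.sum_congr rfl fun x _ ↦ ?_
    rw [Nat.card_zmod]
    rcases eq_or_ne x 0 with rfl | hx
    · rw [inv_zero, zero_mul, zero_pow (by omega)]
    · obtain ⟨m, hm⟩ : ∃ m, q ^ i = m + 1 := ⟨q ^ i - 1, by omega⟩
      rw [hm, pow_succ', inv_mul_cancel_left₀ hx, Nat.add_sub_cancel]

variable [IsDomain R] {Γ₀ κ : Type*} [LinearOrderedCommGroupWithZero Γ₀] [Field κ]

omit [IsDomain R] in
theorem valuation_eq_one_of_isUnit (w : Valuation R Γ₀) (hw : ∀ r, w r ≤ 1) {r : R}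
    (hr : IsUnit r) : w r = 1 := by
  obtain ⟨s, rfl⟩ := hr
  refine le_antisymm (hw _) ?_
  calc (1 : Γ₀) = w (s : R) * w ((s⁻¹ : Rˣ) : R) := by rw [← map_mul]; simp
    _ ≤ w (s : R) * 1 := by gcongr; exact hw _
    _ = _ := mul_one _

/-- A valuation takes the same value at `ξ ^ k - 1` for all `k` prime to the order of the root of
unity `ξ`, so the product formula for `q` gives its value at `q`. -/
theorem valuation_natCast_prime (w : Valuation R Γ₀) (hw : ∀ r, w r ≤ 1) {ξ : R}
    (hξ : IsPrimitiveRoot ξ q) : w (q : R) = w (ξ - 1) ^ (q - 1) := by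
  have hq := (Fact.out : q.Prime)
  have key : ∀ k < q - 1, w (1 - ξ ^ (k + 1)) = w (ξ - 1) := by
    intro k hk
    rw [Valuation.map_sub_swap]
    have hco : (k + 1).Coprime q :=
      (Nat.coprime_of_lt_prime (by omega) (by omega) hq).symm
    obtain ⟨s, hs⟩ := (hξ.associated_sub_one_pow_sub_one_of_coprime hco)
    rw [← hs, map_mul, valuation_eq_one_of_isUnit w hw s.isUnit, mul_one]
  obtain ⟨m, hm⟩ : ∃ m, q = m + 1 := ⟨q - 1, by have := hq.pos; omega⟩
  have h1 := (hm ▸ hξ : IsPrimitiveRoot ξ (m + 1)).prod_one_sub_pow_eq_order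
  have h2 : (q : R) = m + 1 := by rw [hm]; push_cast; rfl
  rw [h2, ← h1, map_prod, Finset.prod_congr rfl (fun k hk ↦ key k (by
    have := Finset.mem_range.1 hk; omega))]
  simp [hm]

section

variable (w : Valuation R Γ₀) (hw : ∀ r, w r ≤ 1) (hw0 : ∀ r, w r = 0 → r = 0)
  (red : R →+* κ) (hred : ∀ r, red r = 0 ↔ w r < 1) (ι : F →+* κ) (ω : MulChar F R)
  (hω : ∀ x, red (ω x) = ι x) {ξ : R} (hξ : IsPrimitiveRoot ξ q) {f : ℕ}
  (hf : Fintype.card F = q ^ f)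

include hω hf in
omit [Fact q.Prime] [Algebra (ZMod q) F] [IsDomain R] in
theorem inv_pow_ne_one_of_reduction {k : ℕ} (hk0 : k ≠ 0) (hk : k < q ^ f - 1) :
    (ω⁻¹) ^ k ≠ 1 := by
  classical
  intro h
  have h1 : ∀ x : Fˣ, x ^ k = 1 := by
    intro x
    have h2 := DFunLike.congr_fun h ((x⁻¹ : Fˣ) : F)
    rw [MulChar.pow_apply_coe, MulChar.one_apply_coe, MulChar.inv_apply'] at h2
    have h3 := congrArg red h2
    rw [map_pow, hω, map_one, ← map_pow, ← map_one ι] at h3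
    have h4 := ι.injective h3
    ext
    simpa using h4
  have h5 := (FiniteField.forall_pow_eq_one_iff F k).1 h1
  rw [hf] at h5
  exact absurd (Nat.le_of_dvd (Nat.pos_of_ne_zero hk0) h5) (by omega)

include hw hred ι hω hξ hf in
/-- Modulo `(ξ - 1) ^ 2` the Gauss sum of the inverse of the Teichmüller character is
`(ξ - 1) ∑ x⁻¹ Tr(x) = -(ξ - 1)`. -/
theorem valuation_gaussSum_inv_teichmuller (h1 : 1 < q ^ f - 1) :
    w (gaussSum ω⁻¹ (traceChar q hξ.pow_eq_one)) = w (ξ - 1) := by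
  have hne : ω⁻¹ ≠ 1 := by
    simpa using inv_pow_ne_one_of_reduction red ι ω hω hf one_ne_zero h1
  have hpow : ∀ m : ℕ, ∃ c : R, ξ ^ m = 1 + (ξ - 1) * c ∧ red c = m := by
    intro m
    have hq0 : red ξ = 1 := by
      have hchar : CharP κ q := by
        have : CharP F q := (Algebra.charP_iff (ZMod q) F q).1 inferInstance
        exact (RingHom.charP_iff ι ι.injective q).1 this
      have e : (red ξ - 1) ^ q = 0 := by
        rw [sub_pow_char, one_pow, ← map_pow, hξ.pow_eq_one, map_one, sub_self]
      exact sub_eq_zero.1 (pow_eq_zero_iff (Fact.out : q.Prime).ne_zero |>.1 e)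
    refine ⟨∑ i ∈ Finset.range m, ξ ^ i, ?_, ?_⟩
    · rw [mul_geom_sum]; ring
    · simp [hq0]
  choose c hc hcr using hpow
  have e1 : gaussSum ω⁻¹ (traceChar q hξ.pow_eq_one)
      = (ξ - 1) * ∑ x : F, ω⁻¹ x * c (Algebra.trace (ZMod q) F x).val := by
    rw [gaussSum, Finset.mul_sum]
    have : ∀ x : F, ω⁻¹ x * traceChar q hξ.pow_eq_one x
        = ω⁻¹ x + (ξ - 1) * (ω⁻¹ x * c (Algebra.trace (ZMod q) F x).val) := by
      intro x
      rw [traceChar_apply, hc]; ring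
    simp_rw [this]
    rw [Finset.sum_add_distrib, MulChar.sum_eq_zero_of_ne_one hne, zero_add]
  have e2 : red (∑ x : F, ω⁻¹ x * c (Algebra.trace (ZMod q) F x).val) = -1 := by
    rw [← map_one ι, ← map_neg, ← sum_inv_mul_trace (q := q) hf, map_sum, map_sum]
    refine Finset.sum_congr rfl fun x _ ↦ ?_
    rw [map_mul, map_mul, hcr, MulChar.inv_apply', hω]
    congr 1
    rw [← map_natCast (ι.comp (algebraMap (ZMod q) F)), ZMod.natCast_zmod_val]
    rfl
  rw [e1, map_mul]
  have e3 : w (∑ x : F, ω⁻¹ x * c (Algebra.trace (ZMod q) F x).val) = 1 := by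
    refine le_antisymm (hw _) (not_lt.1 fun h ↦ ?_)
    rw [← hred, e2] at h
    simp at h
  rw [e3, mul_one]

include hw hred ι hω hξ hf in
/-- Subadditivity: `g_j g_1` is the product of `g_{j+1}` and a Jacobi sum, and `g_{q k} = g_k`. -/
theorem pow_sum_digits_le_valuation_gaussSum (k : ℕ) (hk : k < q ^ f - 1) :
    w (ξ - 1) ^ (Nat.digits q k).sum
      ≤ w (gaussSum ((ω⁻¹) ^ k) (traceChar q hξ.pow_eq_one)) := by
  have hq := (Fact.out : q.Prime)
  induction k using Nat.strong_induction_on with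
  | _ k ih =>
  rcases eq_or_ne k 0 with rfl | hk0
  · have : (traceChar (F := F) q hξ.pow_eq_one) ≠ 1 := by
      have := traceChar_isPrimitive (F := F) hξ (a := 1) one_ne_zero
      rwa [AddChar.mulShift_one] at this
    rw [pow_zero, gaussSum_one_left this]
    simp
  have hmod := Nat.mod_add_div k q
  rcases Nat.eq_zero_or_pos (k % q) with hr | hr
  · have h1 : k = q * (k / q) := by omega
    have h2 : k / q < k := Nat.div_lt_self (by omega) hq.one_lt
    have h3 := sum_digits_add_mul hq.one_lt (k / q) hq.pos
    rw [zero_add, zero_add] at h3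
    rw [h1, h3, mul_comm q, pow_mul, gaussSum_pow_char]
    exact ih _ h2 (by omega)
  · obtain ⟨j, rfl⟩ : ∃ j, k = j + 1 := ⟨k - 1, by omega⟩
    have hlt : (j + 1) % q < q := Nat.mod_lt _ hq.pos
    have h1 : (Nat.digits q (j + 1)).sum = (Nat.digits q j).sum + 1 := by
      have e1 := sum_digits_add_mul hq.one_lt ((j + 1) / q) hlt
      have e2 := sum_digits_add_mul hq.one_lt ((j + 1) / q) (r := (j + 1) % q - 1) (by omega)
      rw [hmod] at e1
      rw [show (j + 1) % q - 1 + q * ((j + 1) / q) = j by omega] at e2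
      omega
    have h2 := jacobiSum_mul_nontrivial (χ := (ω⁻¹) ^ j) (φ := ω⁻¹)
      (by rw [← pow_succ]; exact inv_pow_ne_one_of_reduction red ι ω hω hf hk0 hk)
      (traceChar q hξ.pow_eq_one)
    rw [← pow_succ] at h2
    have h3 := congrArg w h2
    rw [map_mul, map_mul] at h3
    calc w (ξ - 1) ^ (Nat.digits q (j + 1)).sum
        = w (ξ - 1) ^ (Nat.digits q j).sum * w (ξ - 1) := by rw [h1, pow_succ]
      _ ≤ w (gaussSum ((ω⁻¹) ^ j) (traceChar q hξ.pow_eq_one)) *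
          w (gaussSum ω⁻¹ (traceChar q hξ.pow_eq_one)) := by
        rw [valuation_gaussSum_inv_teichmuller w hw red hred ι ω hω hξ hf (by omega)]
        gcongr
        exact ih j (by omega) (by omega)
      _ = _ := h3.symm
      _ ≤ w (gaussSum ((ω⁻¹) ^ (j + 1)) (traceChar q hξ.pow_eq_one)) * 1 := by
        gcongr; exact hw _
      _ = _ := mul_one _

include hf in
omit [Fact q.Prime] [Algebra (ZMod q) F] [IsDomain R] in
theorem inv_pow_card_sub_one : (ω⁻¹) ^ (q ^ f - 1) = 1 := by
  classical
  have := MulChar.pow_card_eq_one (χ := ω⁻¹)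
  rwa [Fintype.card_units, hf] at this

include hw hw0 hred ι hω hξ hf in
/-- **Stickelberger's theorem**: the Gauss sum of the `k`-th power of the inverse of the
Teichmüller character has the valuation of `(ξ - 1) ^ s`, where `s` is the sum of the digits of `k`
in base `q`. One inequality is subadditivity; equality holds because the Gauss sums for `k` and
`q ^ f - 1 - k` have product `± q ^ f`. -/
theorem valuation_gaussSum (k : ℕ) (hk : k < q ^ f - 1) :
    w (gaussSum ((ω⁻¹) ^ k) (traceChar q hξ.pow_eq_one))
      = w (ξ - 1) ^ (Nat.digits q k).sum := by
  have hq := (Fact.out : q.Prime)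
  have hle := pow_sum_digits_le_valuation_gaussSum w hw red hred ι ω hω hξ hf
  rcases eq_or_ne k 0 with rfl | hk0
  · refine le_antisymm ?_ (hle 0 hk)
    simpa using hw _
  refine le_antisymm ?_ (hle k hk)
  have hne := inv_pow_ne_one_of_reduction red ι ω hω hf hk0 hk
  have h1 := gaussSum_mul_gaussSum_eq_card hne (traceChar_isPrimitive (F := F) hξ)
  have h2 := mul_gaussSum_inv_eq_gaussSum ((ω⁻¹) ^ k)⁻¹ (traceChar (F := F) q hξ.pow_eq_one)
  have h3 : ((ω⁻¹) ^ k)⁻¹ = (ω⁻¹) ^ (q ^ f - 1 - k) := by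
    rw [inv_eq_iff_mul_eq_one, ← pow_add, show k + (q ^ f - 1 - k) = q ^ f - 1 by omega]
    exact inv_pow_card_sub_one ω hf
  have hu : w (((ω⁻¹) ^ k)⁻¹ (-1)) = 1 :=
    valuation_eq_one_of_isUnit w hw (IsUnit.map _ isUnit_one.neg)
  have h4 := congrArg w h2
  rw [map_mul, hu, one_mul, h3] at h4
  have h5 := congrArg w h1
  rw [map_mul, h3, h4, hf, Nat.cast_pow, map_pow, valuation_natCast_prime w hw hξ, ← pow_mul,
    mul_comm (q - 1), ← sum_digits_complement hq.one_lt f k (by omega), pow_add] at h5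
  have hx : 0 < w (ξ - 1) := by
    rw [zero_lt_iff]
    intro h
    exact hξ.ne_one hq.one_lt (sub_eq_zero.1 (hw0 _ h))
  have h6 := hle (q ^ f - 1 - k) (by omega)
  refine le_of_mul_le_mul_right ?_ (pow_pos hx (Nat.digits q (q ^ f - 1 - k)).sum)
  rw [← h5]
  gcongr

end

end Stickelberger

/-! ### The `p`-th power of a Gauss sum modulo `(ζ - 1) ^ (p + 1)` -/

/-- The binomial expansion of `(z - 1) ^ p` to second order modulo `p`. -/
theorem exists_sub_one_pow_eq {R : Type*} [CommRing R] {p : ℕ} (hp : p.Prime) (hodd : Odd p)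
    (z : R) : ∃ s : R, (z - 1) ^ p = z ^ p + p * z - 1 + p * z ^ 2 * s := by
  obtain ⟨m, rfl⟩ : ∃ m, p = m + 2 := ⟨p - 2, by have := hp.two_le; omega⟩
  have hm : Odd m := by
    rcases hodd with ⟨a, ha⟩
    exact ⟨a - 1, by omega⟩
  have key : ∀ k ∈ Finset.range m,
      ((m + 2 : ℕ) : R) * z ^ 2 ∣ z ^ (k + 1 + 1) * (-1) ^ (m + 2 - (k + 1 + 1)) *
        ((m + 2).choose (k + 1 + 1) : R) := by
    intro k hk
    have hk := Finset.mem_range.1 hk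
    obtain ⟨d, hd⟩ := hp.dvd_choose_self (k := k + 1 + 1) (by omega) (by omega)
    rw [hd]
    exact ⟨z ^ k * (-1) ^ (m + 2 - (k + 1 + 1)) * d, by push_cast; ring⟩
  obtain ⟨s, hs⟩ := Finset.dvd_sum key
  refine ⟨s, ?_⟩
  rw [sub_eq_add_neg, add_pow, Finset.sum_range_succ, Finset.sum_range_succ',
    Finset.sum_range_succ', hs]
  have e1 : (-1 : R) ^ (m + 2 - (0 + 1)) = 1 := by
    rw [show m + 2 - (0 + 1) = m + 1 by omega, (hm.add_one).neg_one_pow]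
  have e2 : (-1 : R) ^ (m + 2 - 0) = -1 := hodd.neg_one_pow
  rw [e1, e2]
  simp
  ring

section

variable {R : Type*} [CommRing R] [IsDomain R] {p : ℕ} [Fact p.Prime] {ζ : R}
  (hζ : IsPrimitiveRoot ζ p)

omit [IsDomain R] in
theorem root_pow_eq_one_add (ζ : R) (k : ℕ) :
    ∃ c : R, ζ ^ k = 1 + (ζ - 1) * c ∧ ζ - 1 ∣ c - k := by
  refine ⟨∑ i ∈ Finset.range k, ζ ^ i, by rw [mul_geom_sum]; ring, ?_⟩
  have : ∑ i ∈ Finset.range k, ζ ^ i - (k : R) = ∑ i ∈ Finset.range k, (ζ ^ i - 1) := by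
    simp
  rw [this]
  exact Finset.dvd_sum fun i _ ↦ sub_one_dvd_pow_sub_one ζ i

include hζ in
/-- `p ≡ -(ζ - 1) ^ (p - 1)` modulo `(ζ - 1) ^ p`: up to sign `p` is the product of the
`ζ ^ k - 1`, and `(p - 1)! ≡ -1` by Wilson's theorem. -/
theorem exists_prime_eq : ∃ r : R, (p : R) = -(ζ - 1) ^ (p - 1) + (ζ - 1) ^ p * r := by
  have hp := (Fact.out : p.Prime)
  obtain ⟨m, hm⟩ : ∃ m, p = m + 1 := ⟨p - 1, by have := hp.pos; omega⟩
  have h1 := (hm ▸ hζ : IsPrimitiveRoot ζ (m + 1)).prod_one_sub_pow_eq_order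
  choose c hc hcd using fun k : ℕ ↦ root_pow_eq_one_add ζ k
  have h2 : (p : R) = (ζ - 1) ^ m * ∏ k ∈ Finset.range m, (-c (k + 1)) := by
    rw [hm, Nat.cast_add, Nat.cast_one, ← h1]
    rw [← Finset.card_range m, ← Finset.prod_const, Finset.card_range, ← Finset.prod_mul_distrib]
    refine Finset.prod_congr rfl fun k _ ↦ ?_
    rw [hc]; ring
  rcases Nat.eq_zero_or_pos m with h0 | h0
  · exact absurd hp (by rw [hm, h0]; decide)
  have hdvd : ζ - 1 ∣ (p : R) := by
    rw [h2]
    exact Dvd.dvd.mul_right (dvd_pow_self _ h0.ne') _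
  set I := Ideal.span {ζ - 1}
  have h3 : Ideal.Quotient.mk I (∏ k ∈ Finset.range m, (-c (k + 1))) =
      Ideal.Quotient.mk I (-1) := by
    have hW : ((p - 1).factorial : ZMod p) = -1 := ZMod.wilsons_lemma p
    have hW' : (p : ℤ) ∣ ((p - 1).factorial : ℤ) + 1 := by
      rw [← ZMod.intCast_zmod_eq_zero_iff_dvd]
      push_cast
      rw [hW]; ring
    have hW2 : ζ - 1 ∣ ((p - 1).factorial : R) + 1 := by
      refine hdvd.trans ?_
      have := map_dvd (Int.castRingHom R) hW'
      simpa using this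
    have e1 : ∀ k, Ideal.Quotient.mk I (c k) = (k : R ⧸ I) := by
      intro k
      rw [← map_natCast (Ideal.Quotient.mk I), Ideal.Quotient.eq, Ideal.mem_span_singleton]
      exact hcd k
    have e2 : ((p - 1).factorial : R ⧸ I) = -1 := by
      rw [← map_natCast (Ideal.Quotient.mk I), ← map_one (Ideal.Quotient.mk I), ← map_neg,
        Ideal.Quotient.eq, Ideal.mem_span_singleton, sub_neg_eq_add]
      exact hW2
    have hp0 : (p : R ⧸ I) = 0 := by
      rw [← map_natCast (Ideal.Quotient.mk I), Ideal.Quotient.eq_zero_iff_mem,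
        Ideal.mem_span_singleton]
      exact hdvd
    have e3 : ((m.factorial : ℕ) : R ⧸ I) = ∏ k ∈ Finset.range m, ((k + 1 : ℕ) : R ⧸ I) := by
      rw [← Finset.prod_range_add_one_eq_factorial]; push_cast; rfl
    rw [map_prod, map_neg, map_one]
    simp_rw [map_neg, e1]
    rw [Finset.prod_neg, Finset.card_range, ← e3, show m = p - 1 by omega, e2]
    rcases hp.eq_two_or_odd' with h | h
    · subst h
      have : (2 : R ⧸ I) = 0 := by simpa using hp0
      have h11 : (1 : R ⧸ I) = -1 := by linear_combination this
      simp [← h11]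
    · have : Even (p - 1) := by
        rcases h with ⟨a, ha⟩
        exact ⟨a, by omega⟩
      rw [this.neg_one_pow, one_mul]
  rw [Ideal.Quotient.eq, Ideal.mem_span_singleton] at h3
  obtain ⟨r, hr⟩ := h3
  refine ⟨r, ?_⟩
  rw [h2, sub_eq_iff_eq_add.1 hr, show p - 1 = m by omega, hm, pow_succ]
  ring

include hζ in
theorem root_sub_one_dvd_prime : ζ - 1 ∣ (p : R) := by
  obtain ⟨r, hr⟩ := exists_prime_eq hζ
  have hp := (Fact.out : p.Prime)
  rw [hr]
  refine dvd_add ((dvd_neg).2 (dvd_pow_self _ ?_)) ((dvd_pow_self _ hp.ne_zero).mul_right _)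
  have := hp.two_le
  omega

include hζ in
/-- The Gauss sum is `-1 + (ζ - 1) t` with `t = ∑ c(x) ψ(x)`, where `c` is logarithmic modulo
`ζ - 1`. Its `p`-th power is therefore `-1 + (ζ - 1) ^ p (t ^ p - t)` to the given precision, and
`t ^ p - t` reduces to the value of `c` at `p`, as raising to the `p`-th power replaces `ψ(x)`
by `ψ(p x)`. -/
theorem gaussSum_pow_prime_congr {F : Type*} [Field F] [Fintype F] (hodd : Odd p)
    (hu : ¬ IsUnit (ζ - 1)) (χ : MulChar F R) (hχ : ∀ x ≠ 0, ∃ k : ℕ, χ x = ζ ^ k)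
    {ψ : AddChar F R} (hψ : ψ ≠ 1) (hpF : (p : F) ≠ 0) :
    ∃ c : R, χ (p : F) = 1 + (ζ - 1) * c ∧
      (ζ - 1) ^ (p + 1) ∣ gaussSum χ ψ ^ p + 1 - c * (ζ - 1) ^ p := by
  classical
  have hp := (Fact.out : p.Prime)
  have hl : ζ - 1 ≠ 0 := sub_ne_zero.2 (hζ.ne_one hp.one_lt)
  have hpd := root_sub_one_dvd_prime hζ
  set I := Ideal.span {ζ - 1} with hI
  set π := Ideal.Quotient.mk I with hπ
  have hp0 : (p : R ⧸ I) = 0 := by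
    rw [← map_natCast π, Ideal.Quotient.eq_zero_iff_mem, Ideal.mem_span_singleton]
    exact hpd
  have hnt : Nontrivial (R ⧸ I) := by
    refine Ideal.Quotient.nontrivial_iff.2 fun h ↦ hu ?_
    exact Ideal.span_singleton_eq_top.1 h
  have hchar : CharP (R ⧸ I) p := (CharP.charP_iff_prime_eq_zero hp).2 hp0
  have hex : ∀ x : F, ∃ c : R, χ x = (1 : MulChar F R) x + (ζ - 1) * c ∧ π c ^ p = π c ∧
      (x = 0 → c = 0) := by
    intro x
    rcases eq_or_ne x 0 with rfl | hx
    · exact ⟨0, by simp [MulChar.map_zero], by simp [hp.ne_zero], fun _ ↦ rfl⟩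
    · obtain ⟨k, hk⟩ := hχ x hx
      obtain ⟨c, hc, hcd⟩ := root_pow_eq_one_add ζ k
      refine ⟨c, by rw [hk, hc, MulChar.one_apply (isUnit_iff_ne_zero.2 hx)], ?_,
        fun h ↦ absurd h hx⟩
      have : π c = (k : R ⧸ I) := by
        rw [← map_natCast π, Ideal.Quotient.eq, Ideal.mem_span_singleton]
        exact hcd
      rw [this]
      have h1 : ((k : ZMod p)) ^ p = k := ZMod.pow_card _
      have h2 := congrArg (ZMod.castHom (dvd_refl p) (R ⧸ I)) h1
      rwa [map_pow, map_natCast] at h2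
  choose c hc hcp hc0 using hex
  have hmul : ∀ x y : F, x ≠ 0 → y ≠ 0 → π (c (x * y)) = π (c x) + π (c y) := by
    intro x y hx hy
    have h1 := hc (x * y)
    rw [map_mul, hc x, hc y, MulChar.one_apply (isUnit_iff_ne_zero.2 hx),
      MulChar.one_apply (isUnit_iff_ne_zero.2 hy),
      MulChar.one_apply (isUnit_iff_ne_zero.2 (mul_ne_zero hx hy))] at h1
    have h2 : (ζ - 1) * c (x * y) = (ζ - 1) * (c x + c y + (ζ - 1) * (c x * c y)) := by
      linear_combination -h1
    rw [mul_left_cancel₀ hl h2, map_add, map_add, map_mul]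
    have : π (ζ - 1) = 0 := Ideal.Quotient.eq_zero_iff_mem.2 (Ideal.mem_span_singleton_self _)
    rw [this, zero_mul, add_zero]
  have hsum1 : ∑ x : F, (1 : MulChar F R) x * ψ x = -1 := gaussSum_one_left hψ
  set t := ∑ x : F, c x * ψ x with ht
  have hg : gaussSum χ ψ = (ζ - 1) * t - 1 := by
    calc gaussSum χ ψ = ∑ x : F, ((1 : MulChar F R) x * ψ x + (ζ - 1) * (c x * ψ x)) := by
          refine Finset.sum_congr rfl fun x _ ↦ ?_
          rw [hc x]; ring
      _ = (ζ - 1) * t - 1 := by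
          rw [Finset.sum_add_distrib, ← Finset.mul_sum, hsum1, ht]; ring
  have htp : π t ^ p = π t + π (c p) := by
    have h1 : π t ^ p = ∑ x : F, π (c x) * π (ψ (p * x)) := by
      rw [ht, map_sum, sum_pow_char]
      refine Finset.sum_congr rfl fun x _ ↦ ?_
      rw [map_mul, mul_pow, hcp, ← map_pow, ← AddChar.map_nsmul_eq_pow, nsmul_eq_mul]
    have h2 : π t = ∑ x : F, π (c (p * x)) * π (ψ (p * x)) := by
      rw [ht, map_sum]
      refine (Fintype.sum_bijective _ (mulLeft_bijective₀ (p : F) hpF) _ _ fun x ↦ ?_).symm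
      rw [map_mul π]
    have h3 : ∑ x : F, π ((1 : MulChar F R) x) * π (ψ (p * x)) = -1 := by
      rw [← map_one π, ← map_neg, ← hsum1, map_sum]
      refine Fintype.sum_bijective _ (mulLeft_bijective₀ (p : F) hpF) _ _ fun x ↦ ?_
      rw [map_mul π, map_mul (1 : MulChar F R), MulChar.one_apply (isUnit_iff_ne_zero.2 hpF),
        one_mul]
    have h4 : ∀ x : F, π (c (p * x)) * π (ψ (p * x)) =
        π (c p) * (π ((1 : MulChar F R) x) * π (ψ (p * x))) + π (c x) * π (ψ (p * x)) := by
      intro x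
      rcases eq_or_ne x 0 with rfl | hx
      · simp [hc0 0 rfl, MulChar.map_zero]
      · rw [hmul _ _ hpF hx, MulChar.one_apply (isUnit_iff_ne_zero.2 hx), map_one]; ring
    rw [h1, h2]
    simp_rw [h4]
    rw [Finset.sum_add_distrib, ← Finset.mul_sum, h3]; ring
  refine ⟨c p, by rw [hc, MulChar.one_apply (isUnit_iff_ne_zero.2 hpF)], ?_⟩
  have hd : ζ - 1 ∣ t ^ p - t - c p := by
    rw [← Ideal.mem_span_singleton, ← hI, ← Ideal.Quotient.eq_zero_iff_mem, ← hπ]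
    rw [map_sub, map_sub, map_pow, htp]; ring
  obtain ⟨e, he⟩ := hd
  obtain ⟨r, hr⟩ := exists_prime_eq hζ
  obtain ⟨s, hs⟩ := exists_sub_one_pow_eq hp hodd ((ζ - 1) * t)
  obtain ⟨m, hm⟩ : ∃ m, p = m + 1 := ⟨p - 1, by have := hp.pos; omega⟩
  rw [hg, hs]
  refine ⟨e + r * t - t ^ 2 * s + (ζ - 1) * r * t ^ 2 * s, ?_⟩
  rw [show p - 1 = m by omega] at hr
  have hpow : (ζ - 1) ^ p = (ζ - 1) * (ζ - 1) ^ m := by rw [hm, pow_succ]; ring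
  rw [pow_succ (ζ - 1) p, mul_pow (ζ - 1) t p]
  rw [hpow] at hr ⊢
  rw [hr]
  linear_combination (ζ - 1) * (ζ - 1) ^ m * he

include hζ in
theorem pow_prime_congr_of_congr (hodd : Odd p) {y c : R}
    (hy : (ζ - 1) ^ (p + 1) ∣ y + 1 - c * (ζ - 1) ^ p) :
    (ζ - 1) ^ (2 * p) ∣ y ^ p + 1 + c * (ζ - 1) ^ (2 * p - 1) := by
  have hp := (Fact.out : p.Prime)
  obtain ⟨e, he⟩ := hy
  obtain ⟨r, hr⟩ := exists_prime_eq hζ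
  obtain ⟨s, hs⟩ := exists_sub_one_pow_eq hp hodd ((ζ - 1) ^ p * (c + (ζ - 1) * e))
  have hy' : y = (ζ - 1) ^ p * (c + (ζ - 1) * e) - 1 := by
    rw [pow_succ] at he
    linear_combination he
  rw [hy', hs]
  have h1 : (ζ - 1) ^ (2 * p) ∣ ((ζ - 1) ^ p * (c + (ζ - 1) * e)) ^ p := by
    rw [mul_pow, ← pow_mul]
    exact (pow_dvd_pow _ (Nat.mul_le_mul_right _ hp.two_le)).mul_right _
  have h2 : (ζ - 1) ^ (2 * p) ∣ (p : R) * ((ζ - 1) ^ p * (c + (ζ - 1) * e)) ^ 2 * s := by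
    refine Dvd.dvd.mul_right (Dvd.dvd.mul_left ?_ _) _
    rw [mul_pow, ← pow_mul, mul_comm p]
    exact Dvd.intro _ rfl
  have h3 : (ζ - 1) ^ (2 * p) ∣
      (p : R) * ((ζ - 1) ^ p * (c + (ζ - 1) * e)) + c * (ζ - 1) ^ (2 * p - 1) := by
    obtain ⟨m, hm⟩ : ∃ m, p = m + 1 := ⟨p - 1, by have := hp.pos; omega⟩
    rw [show p - 1 = m by omega] at hr
    rw [hr, show 2 * p - 1 = p + m by omega]
    refine ⟨-e + r * (c + (ζ - 1) * e), ?_⟩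
    have hpow : (ζ - 1) ^ p = (ζ - 1) * (ζ - 1) ^ m := by rw [hm, pow_succ]; ring
    rw [two_mul, pow_add, pow_add, hpow]
    ring
  have := dvd_add (dvd_add h1 h2) h3
  convert this using 1
  ring

end

/-! ### The Galois action on the cyclotomic field -/

section Galois

variable {p : ℕ} [Fact p.Prime] {K : Type*} [Field K] [NumberField K]
  [IsCyclotomicExtension {p} ℚ K]

open IsCyclotomicExtension.Rat

/-- The automorphism of the `p`-th cyclotomic field `K` that raises the `p`-th roots of unity to
the power `t`. -/
noncomputable def galOf (K : Type*) [Field K] [NumberField K] [IsCyclotomicExtension {p} ℚ K]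
    (t : (ZMod p)ˣ) : K ≃ₐ[ℚ] K :=
  (galEquivZMod p K).symm t

theorem galEquivZMod_galOf (t : (ZMod p)ˣ) : galEquivZMod p K (galOf K t) = t :=
  (galEquivZMod p K).apply_symm_apply t

theorem galOf_galEquivZMod (σ : K ≃ₐ[ℚ] K) : galOf K (galEquivZMod p K σ) = σ :=
  (galEquivZMod p K).symm_apply_apply σ

theorem galOf_mul (s t : (ZMod p)ˣ) : galOf K (s * t) = galOf K s * galOf K t :=
  map_mul (galEquivZMod p K).symm s t

theorem galOf_smul_smul (s t : (ZMod p)ˣ) (x : 𝓞 K) :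
    galOf K s • galOf K t • x = galOf K (s * t) • x := by
  rw [galOf_mul, mul_smul]

theorem galOf_smul_of_pow_eq_one (t : (ZMod p)ˣ) {x : 𝓞 K} (hx : x ^ p = 1) :
    galOf K t • x = x ^ (t : ZMod p).val := by
  rw [galEquivZMod_smul_of_pow_eq p K _ hx, galEquivZMod_galOf]

theorem galEquivZMod_eq {ζ : K} (hζ : IsPrimitiveRoot ζ p) {v : (ZMod p)ˣ} {σ : K ≃ₐ[ℚ] K}
    (hσ : σ ζ = ζ ^ (v : ZMod p).val) : galEquivZMod p K σ = v := by
  have h := galEquivZMod_apply_of_pow_eq p K σ hζ.pow_eq_one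
  rw [hσ] at h
  have h2 := hζ.pow_inj (ZMod.val_lt _) (ZMod.val_lt _) h
  exact (Units.ext (ZMod.val_injective p h2)).symm

theorem powP_eq {v : (ZMod p)ˣ} (hv : orderOf v = p - 1) {σ : K ≃ₐ[ℚ] K}
    (hσ : galEquivZMod p K σ = v) (A : 𝓞 K) :
    powP p σ v A = ∏ u : (ZMod p)ˣ, (galOf K u • A) ^ ((u⁻¹ : (ZMod p)ˣ) : ZMod p).val := by
  have hcard : Fintype.card (ZMod p)ˣ = p - 1 := ZMod.card_units p
  rw [powP]
  refine Finset.prod_bij (fun i _ ↦ v ^ i) (fun _ _ ↦ Finset.mem_univ _) ?_ ?_ ?_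
  · intro i hi j hj hij
    exact pow_injOn_Iio_orderOf (by simpa [hv] using hi) (by simpa [hv] using hj) hij
  · intro u _
    have htop : u ∈ Subgroup.zpowers v := by
      have h1 : Subgroup.zpowers v = ⊤ := by
        rw [← Subgroup.card_eq_iff_eq_top, Nat.card_zpowers, hv, Nat.card_eq_fintype_card, hcard]
      rw [h1]; trivial
    obtain ⟨i, hi, h⟩ := (mem_zpowers_iff_mem_range_orderOf.1 htop |> Finset.mem_image.1)
    exact ⟨i, by rwa [hv] at hi, h⟩
  · intro i _
    rw [inv_pow]
    congr 2
    rw [← galOf_galEquivZMod (p := p) (σ ^ i), map_pow, hσ]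

theorem galOf_smul_prod (t : (ZMod p)ˣ) (A : 𝓞 K) :
    galOf K t • ∏ u : (ZMod p)ˣ, (galOf K u • A) ^ ((u⁻¹ : (ZMod p)ˣ) : ZMod p).val
      = ∏ u : (ZMod p)ˣ, (galOf K u • A) ^ ((t * u⁻¹ : (ZMod p)ˣ) : ZMod p).val := by
  rw [Finset.smul_prod']
  refine Fintype.prod_equiv (Equiv.mulLeft t) _ _ fun u ↦ ?_
  rw [smul_pow', galOf_smul_smul, Equiv.coe_mulLeft]
  congr 3
  simp

/-- Complex conjugation replaces the exponents `v^{-i}` by `p - v^{-i}`. -/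
theorem prod_mul_galOf_neg_one_smul (A : 𝓞 K) :
    (∏ u : (ZMod p)ˣ, (galOf K u • A) ^ ((u⁻¹ : (ZMod p)ˣ) : ZMod p).val) *
      galOf K (-1 : (ZMod p)ˣ) • ∏ u : (ZMod p)ˣ, (galOf K u • A) ^ ((u⁻¹ : (ZMod p)ˣ) : ZMod p).val
      = (∏ u : (ZMod p)ˣ, galOf K u • A) ^ p := by
  rw [galOf_smul_prod, ← Finset.prod_mul_distrib, ← Finset.prod_pow]
  refine Finset.prod_congr rfl fun u _ ↦ ?_
  rw [← pow_add]
  congr 1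
  have h : ((u⁻¹ : (ZMod p)ˣ) : ZMod p) ≠ 0 := Units.ne_zero _
  have : NeZero ((u⁻¹ : (ZMod p)ˣ) : ZMod p) := ⟨h⟩
  rw [neg_one_mul, Units.val_neg, ZMod.val_neg_of_ne_zero]
  have := ZMod.val_lt ((u⁻¹ : (ZMod p)ˣ) : ZMod p)
  omega

theorem prod_galOf_smul (A : 𝓞 K) :
    ((∏ u : (ZMod p)ˣ, galOf K u • A : 𝓞 K) : K) = algebraMap ℚ K (Algebra.norm ℚ (A : K)) := by
  have := IsCyclotomicExtension.isGalois {p} ℚ K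
  rw [Algebra.norm_eq_prod_automorphisms]
  change algebraMap (𝓞 K) K _ = _
  rw [map_prod]
  exact Fintype.prod_equiv (galEquivZMod p K).symm.toEquiv _ _ fun u ↦ rfl

theorem norm_embedding_prod_galOf_smul {I : Ideal (𝓞 K)} {A : 𝓞 K}
    (hA : Ideal.span {A} = I) (φ : K →+* ℂ) :
    ‖φ ((∏ u : (ZMod p)ˣ, galOf K u • A : 𝓞 K) : K)‖ = Ideal.absNorm I := by
  rw [prod_galOf_smul, ← hA, Ideal.absNorm_span_singleton, ← Algebra.coe_norm_int]
  simp [Nat.cast_natAbs]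

theorem embedding_galOf_neg_one (φ : K →+* ℂ) (x : K) :
    φ (galOf K (-1 : (ZMod p)ˣ) x) = starRingEnd ℂ (φ x) := by
  have hp := (Fact.out : p.Prime)
  have hζ := IsCyclotomicExtension.zeta_spec p ℚ K
  set ζ := IsCyclotomicExtension.zeta p ℚ K
  let f : K →ₐ[ℚ] ℂ := (φ.comp (galOf K (-1 : (ZMod p)ˣ)).toRingEquiv.toRingHom).toRatAlgHom
  let g : K →ₐ[ℚ] ℂ := ((starRingEnd ℂ).comp φ).toRatAlgHom
  have hfg : f = g := by
    refine (hζ.powerBasis ℚ).algHom_ext ?_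
    rw [IsPrimitiveRoot.powerBasis_gen]
    change φ (galOf K (-1 : (ZMod p)ˣ) ζ) = starRingEnd ℂ (φ ζ)
    rw [galEquivZMod_apply_of_pow_eq p K _ hζ.pow_eq_one, galEquivZMod_galOf, map_pow]
    have h1 : φ ζ ^ p = 1 := by rw [← map_pow, hζ.pow_eq_one, map_one]
    have h2 : φ ζ * φ ζ ^ ((-1 : (ZMod p)ˣ) : ZMod p).val = 1 := by
      rw [← pow_succ']
      have : ((-1 : (ZMod p)ˣ) : ZMod p).val + 1 = p := by
        have : NeZero (1 : ZMod p) := ⟨one_ne_zero⟩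
        rw [Units.val_neg, Units.val_one, ZMod.val_neg_of_ne_zero, ZMod.val_one]
        have := hp.pos
        omega
      rw [this, h1]
    have h3 : ‖φ ζ‖ = 1 := Complex.norm_eq_one_of_pow_eq_one h1 hp.ne_zero
    rw [← Complex.inv_eq_conj h3]
    exact eq_inv_of_mul_eq_one_right h2
  exact DFunLike.congr_fun hfg x

end Galois

/-! ### Valuations and divisibility in Dedekind domains -/

/-- In a Dedekind domain `x` divides `z` as soon as, for every maximal ideal, both have the same
value under some valuation centred at that ideal, which need not be the normalized one: after
cancelling the common factor of `(x)` and `(z)`, a prime factor left over in `(x)` would lower the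
value of `x` but not that of `z`. -/
theorem dvd_of_valuations_eq {R : Type*} [CommRing R] [IsDedekindDomain R] {Γ₀ : Type*}
    [LinearOrderedCommGroupWithZero Γ₀] {x z : R}
    (h : ∀ P : Ideal R, P.IsMaximal → ∃ v : Valuation R Γ₀, (∀ r, r ∉ P → v r = 1) ∧
      (∀ r ∈ P, v r < 1) ∧ v x = v z ∧ v z ≠ 0) (hx : x ≠ 0) : x ∣ z := by
  set I := Ideal.span {x}
  set J := Ideal.span {z}
  have hIG : I ⊔ J ∣ I := Ideal.dvd_iff_le.2 le_sup_left
  have hJG : I ⊔ J ∣ J := Ideal.dvd_iff_le.2 le_sup_right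
  obtain ⟨I', hI'⟩ := hIG
  obtain ⟨J', hJ'⟩ := hJG
  have hG0 : I ⊔ J ≠ 0 := by
    intro h0
    have : x ∈ I ⊔ J := (le_sup_left : I ≤ I ⊔ J) (Ideal.mem_span_singleton_self x)
    rw [h0] at this
    exact hx (by simpa using this)
  have hcop : I' ⊔ J' = ⊤ := by
    have h1 : (I ⊔ J) * (I' ⊔ J') = (I ⊔ J) * 1 := by
      rw [mul_one, Ideal.mul_sup, ← hI', ← hJ']
    rw [mul_left_cancel₀ hG0 h1, Ideal.one_eq_top]
  have hcross : J' * I = I' * J := by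
    calc J' * I = J' * ((I ⊔ J) * I') := by rw [← hI']
      _ = I' * ((I ⊔ J) * J') := by ring
      _ = I' * J := by rw [← hJ']
  have htop : I' = ⊤ := by
    by_contra hne
    obtain ⟨P, hP, hle⟩ := Ideal.exists_le_maximal I' hne
    obtain ⟨v, hv1, hv2, hv, hv0⟩ := h P hP
    have hJ : ¬ J' ≤ P := fun hJ ↦ hP.ne_top (top_le_iff.1 (hcop ▸ sup_le hle hJ))
    obtain ⟨j, hj, hjP⟩ := SetLike.not_le_iff_exists.1 hJ
    have h1 : j * x ∈ I' * J := hcross ▸ Ideal.mul_mem_mul hj (Ideal.mem_span_singleton_self x)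
    obtain ⟨i, hi, hie⟩ := Ideal.mem_mul_span_singleton.1 h1
    have h2 := congrArg v hie
    rw [map_mul, map_mul, hv1 j hjP, one_mul, hv] at h2
    have h3 := hv2 i (hle hi)
    rw [mul_eq_right₀ hv0] at h2
    exact h3.ne h2
  rw [htop, Ideal.mul_top] at hI'
  have : z ∈ I := by
    rw [hI']
    exact (le_sup_right : J ≤ I ⊔ J) (Ideal.mem_span_singleton_self z)
  exact Ideal.mem_span_singleton.1 this

section

open IsCyclotomicExtension.Rat
open scoped Pointwise

variable {p : ℕ} [Fact p.Prime] {K : Type*} [Field K] [NumberField K]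
  [IsCyclotomicExtension {p} ℚ K] {q : ℕ} [Fact q.Prime] (𝔮 : Ideal (𝓞 K)) [𝔮.IsMaximal]
  [𝔮.LiesOver (Ideal.span {(q : ℤ)})] (hqp : q.Coprime p)

include hqp in
theorem exists_span_eq_mul_of_coprime :
    ∃ 𝔟 : Ideal (𝓞 K), Ideal.span {(q : 𝓞 K)} = 𝔮 * 𝔟 ∧ ¬ 𝔟 ≤ 𝔮 := by
  have hq := (Fact.out : q.Prime)
  have hmap : (Ideal.span {(q : ℤ)}).map (algebraMap ℤ (𝓞 K)) = Ideal.span {(q : 𝓞 K)} := by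
    rw [Ideal.map_span]; simp
  have h0 : (Ideal.span {(q : ℤ)}).map (algebraMap ℤ (𝓞 K)) ≠ ⊥ := by
    rw [hmap, Ne, Ideal.span_singleton_eq_bot]
    exact_mod_cast hq.ne_zero
  obtain ⟨I, hI, h⟩ := Ideal.eq_prime_pow_mul_coprime h0 𝔮
  rw [← Ideal.IsDedekindDomain.ramificationIdx_eq_normalizedFactors_count _ _ h0,
    ramificationIdx_eq_of_not_dvd (m := p) q K 𝔮 ((Nat.Prime.coprime_iff_not_dvd hq).1 hqp),
    pow_one, hmap] at h
  refine ⟨I, h, fun hle ↦ ?_⟩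
  rw [sup_eq_left.2 hle] at hI
  exact Ideal.IsPrime.ne_top' hI

variable {Γ₀ : Type*} [LinearOrderedCommGroupWithZero Γ₀] (w : Valuation (𝓞 K) Γ₀)
  (hw1 : ∀ r, r ∉ 𝔮 → w r = 1)

include hw1 hqp in
/-- As `q` is unramified, `q ^ p` and a generator of `𝔮 ^ p` differ locally by a unit. -/
theorem valuation_eq_of_span_eq_pow {A : 𝓞 K} (hA : Ideal.span {A} = 𝔮 ^ p) :
    w A = w (q : 𝓞 K) ^ p := by
  obtain ⟨𝔟, h𝔟, hnle⟩ := exists_span_eq_mul_of_coprime 𝔮 hqp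
  have h1 : Ideal.span {(q : 𝓞 K) ^ p} = Ideal.span {A} * 𝔟 ^ p := by
    rw [← Ideal.span_singleton_pow, h𝔟, mul_pow, hA]
  have h2 : A ∣ (q : 𝓞 K) ^ p := by
    rw [← Ideal.mem_span_singleton]
    exact (h1.le.trans Ideal.mul_le_left) (Ideal.mem_span_singleton_self _)
  obtain ⟨B, hB⟩ := h2
  have hq0 : (q : 𝓞 K) ^ p ≠ 0 := pow_ne_zero _ (by exact_mod_cast (Fact.out : q.Prime).ne_zero)
  have hA0 : Ideal.span {A} ≠ 0 := by
    rw [Ideal.zero_eq_bot, Ne, Ideal.span_singleton_eq_bot]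
    rintro rfl
    exact hq0 (by rw [hB, zero_mul])
  have h3 : Ideal.span {B} = 𝔟 ^ p := by
    rw [hB, ← Ideal.span_singleton_mul_span_singleton] at h1
    exact mul_left_cancel₀ hA0 h1
  have hprime : 𝔮.IsPrime := inferInstance
  have h4 : B ∉ 𝔮 := by
    intro hmem
    rw [← Ideal.span_singleton_le_iff_mem, h3] at hmem
    exact hnle (hprime.le_of_pow_le hmem)
  rw [← map_pow, hB, map_mul, hw1 B h4, mul_one]

include hw1 in
/-- The primes `𝔮` and `u⁻¹ 𝔮` agree exactly when `u` lies in the decomposition group, which is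
generated by the class of `q`. -/
theorem valuation_galOf_smul {A : 𝓞 K} (hA : Ideal.span {A} = 𝔮 ^ p) (u : (ZMod p)ˣ)
    [Decidable (u ∈ Subgroup.zpowers (ZMod.unitOfCoprime q hqp))] :
    w (galOf K u • A) =
      if u ∈ Subgroup.zpowers (ZMod.unitOfCoprime q hqp) then w (q : 𝓞 K) ^ p else 1 := by
  have hstab : u ∈ Subgroup.zpowers (ZMod.unitOfCoprime q hqp) ↔ galOf K u • 𝔮 = 𝔮 := by
    rw [← galEquivZMod_stabilizer p K q 𝔮 hqp, MulEquiv.mapSubgroup_apply]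
    exact Subgroup.mem_map_equiv.trans MulAction.mem_stabilizer_iff
  have hspan : Ideal.span {galOf K u • A} = (galOf K u • 𝔮) ^ p := by
    rw [Ideal.pointwise_smul_def, ← Ideal.map_pow, ← hA, Ideal.map_span, Set.image_singleton]
    rfl
  split_ifs with h
  · rw [hstab] at h
    rw [h] at hspan
    exact valuation_eq_of_span_eq_pow 𝔮 hqp w hw1 hspan
  · refine hw1 _ fun hmem ↦ h (hstab.2 ?_)
    rw [← Ideal.span_singleton_le_iff_mem, hspan] at hmem
    have hprime : 𝔮.IsPrime := inferInstance
    have hle : galOf K u • 𝔮 ≤ 𝔮 := hprime.le_of_pow_le hmem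
    have hmax : (galOf K u • 𝔮).IsMaximal := by
      rw [Ideal.pointwise_smul_eq_comap]
      exact Ideal.comap_isMaximal_of_surjective _ (RingEquiv.surjective _)
    exact hmax.eq_of_le hprime.ne_top hle

omit [Fact q.Prime] in
theorem sum_zpowers_val (t : (ZMod p)ˣ)
    [DecidablePred (· ∈ Subgroup.zpowers (ZMod.unitOfCoprime q hqp))] :
    ∑ u : (ZMod p)ˣ with u ∈ Subgroup.zpowers (ZMod.unitOfCoprime q hqp),
        ((t * u⁻¹ : (ZMod p)ˣ) : ZMod p).val
      = ∑ i ∈ Finset.range (orderOf (q : ZMod p)), (t : ZMod p).val * q ^ i % p := by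
  have hord : orderOf (ZMod.unitOfCoprime q hqp) = orderOf (q : ZMod p) := by
    rw [← orderOf_units, ZMod.coe_unitOfCoprime]
  symm
  refine Finset.sum_bij (fun i _ ↦ (ZMod.unitOfCoprime q hqp ^ i)⁻¹) ?_ ?_ ?_ ?_
  · intro i _
    simp only [Finset.mem_filter, Finset.mem_univ, true_and]
    exact inv_mem (pow_mem (Subgroup.mem_zpowers _) _)
  · intro i hi j hj hij
    exact pow_injOn_Iio_orderOf (by simpa [hord] using hi) (by simpa [hord] using hj)
      (inv_injective hij)
  · intro u hu
    simp only [Finset.mem_filter, Finset.mem_univ, true_and] at hu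
    obtain ⟨i, hi, h⟩ :=
      (mem_zpowers_iff_mem_range_orderOf.1 (inv_mem hu) |> Finset.mem_image.1)
    exact ⟨i, by rwa [hord] at hi, (congrArg _ h).trans (inv_inv u)⟩
  · intro i _
    rw [inv_inv, ← ZMod.val_natCast]
    congr 1
    push_cast
    rw [ZMod.natCast_zmod_val, ZMod.coe_unitOfCoprime]

include hw1 hqp in
theorem valuation_galOf_smul_prod {A : 𝓞 K} (hA : Ideal.span {A} = 𝔮 ^ p) (t : (ZMod p)ˣ) :
    w (galOf K t • ∏ u : (ZMod p)ˣ, (galOf K u • A) ^ ((u⁻¹ : (ZMod p)ˣ) : ZMod p).val)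
      = w (q : 𝓞 K) ^
        (p * ∑ i ∈ Finset.range (orderOf (q : ZMod p)), (t : ZMod p).val * q ^ i % p) := by
  classical
  rw [galOf_smul_prod, map_prod, ← sum_zpowers_val hqp, Finset.mul_sum,
    ← Finset.prod_pow_eq_pow_sum, Finset.prod_filter]
  refine Finset.prod_congr rfl fun u _ ↦ ?_
  rw [map_pow, valuation_galOf_smul 𝔮 hqp w hw1 hA]
  split_ifs
  · rw [pow_mul]
  · rw [one_pow]

omit [Fact q.Prime] [𝔮.IsMaximal] in
/-- The prime ideals of `K` above `q` are permuted transitively. -/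
theorem exists_galOf_smul_eq [𝔮.IsPrime] (P : Ideal (𝓞 K)) [P.IsPrime]
    [P.LiesOver (Ideal.span {(q : ℤ)})] : ∃ t : (ZMod p)ˣ, ∀ x, x ∈ P ↔ galOf K t • x ∈ 𝔮 := by
  have := IsCyclotomicExtension.isGalois {p} ℚ K
  have := IsGaloisGroup.of_isFractionRing (K ≃ₐ[ℚ] K) ℤ (𝓞 K) ℚ K
  have hu : Ideal.under ℤ 𝔮 = Ideal.under ℤ P := by
    rw [← Ideal.over_def 𝔮 (Ideal.span {(q : ℤ)}), ← Ideal.over_def P (Ideal.span {(q : ℤ)})]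
  obtain ⟨g, hg⟩ := Algebra.IsInvariant.exists_smul_of_under_eq ℤ (𝓞 K) (K ≃ₐ[ℚ] K) 𝔮 P hu
  refine ⟨galEquivZMod p K g⁻¹, fun x ↦ ?_⟩
  rw [galOf_galEquivZMod, hg, Ideal.mem_pointwise_smul_iff_inv_smul_mem]

end

/-! ### The Stickelberger element of a prime ideal -/

section Characters

variable {F R : Type*} [Field F] [Fintype F] [CommRing R] [IsDomain R]

/-- The Teichmüller character: the roots of unity of order prime to the residue characteristic
reduce injectively, so the embedding `ι` of `F` in the residue field lifts to a character. -/
theorem exists_teichmuller {κ : Type*} [Field κ] (red : R →+* κ) (ι : F →+* κ) {η : R}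
    (hη : IsPrimitiveRoot η (Fintype.card F - 1)) :
    ∃ ω : MulChar F R, ∀ x, red (ω x) = ι x := by
  classical
  have hcard : Fintype.card Fˣ = Fintype.card F - 1 := Fintype.card_units F
  set N := Fintype.card F - 1 with hN
  have hN0 : 0 < N := hcard ▸ Fintype.card_pos
  have hNκ : (N : κ) = -1 := by
    have h1 : ((N : ℕ) : F) = -1 := by
      rw [hN, Nat.cast_sub Fintype.card_pos, FiniteField.cast_card_eq_zero]
      simp
    have h2 := congrArg ι h1
    simpa using h2
  have hprim : IsPrimitiveRoot (red η) N := by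
    have : NeZero (N : κ) := ⟨by rw [hNκ]; exact neg_ne_zero.2 one_ne_zero⟩
    rw [← Polynomial.isRoot_cyclotomic_iff, ← Polynomial.map_cyclotomic N red]
    exact (hη.isRoot_cyclotomic hN0).map
  obtain ⟨γ, hγ⟩ := IsCyclic.exists_generator (α := Fˣ)
  have hγN : (ι (γ : F)) ^ N = 1 := by
    rw [← map_pow, ← Units.val_pow_eq_pow_val, ← hcard, pow_card_eq_one]
    simp
  have : NeZero N := ⟨hN0.ne'⟩
  obtain ⟨i, -, hi⟩ := hprim.eq_pow_of_pow_eq_one hγN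
  have hunit : IsUnit η := hη.isUnit hN0.ne'
  have hmem : hunit.unit ^ i ∈ rootsOfUnity (Fintype.card Fˣ) R := by
    rw [mem_rootsOfUnity, hcard, ← pow_mul, mul_comm, pow_mul]
    have : hunit.unit ^ N = 1 := by
      ext
      simpa using hη.pow_eq_one
    rw [this, one_pow]
  refine ⟨MulChar.ofRootOfUnity hmem hγ, fun x ↦ ?_⟩
  rcases eq_or_ne x 0 with rfl | hx
  · simp [MulChar.map_zero]
  · have h1 := hγ (Units.mk0 x hx)
    obtain ⟨j, hj⟩ := (mem_powers_iff_mem_zpowers.2 h1)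
    have hj' : x = (γ : F) ^ j := by
      have := congrArg Units.val hj
      simpa using this.symm
    rw [hj', map_pow, map_pow, map_pow, MulChar.ofRootOfUnity_spec]
    congr 1
    simpa using hi

/-- The expression in Jacobi sums of the `p`-th power of the Gauss sum of a character of order
`p`. -/
noncomputable def jacobiProd {R : Type*} [CommRing R] (p : ℕ) (χ : MulChar F R) : R :=
  χ (-1) * Fintype.card F * ∏ i ∈ Finset.Ico 1 (p - 1), jacobiSum χ (χ ^ i)

omit [IsDomain R] in
theorem map_jacobiProd {R' : Type*} [CommRing R'] (p : ℕ) (χ : MulChar F R) (g : R →+* R') :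
    g (jacobiProd p χ) = jacobiProd p (χ.ringHomComp g) := by
  simp only [jacobiProd, map_mul, map_natCast, map_prod, MulChar.ringHomComp_apply,
    MulChar.ringHomComp_pow, jacobiSum_ringHomComp]

theorem gaussSum_pow_eq_jacobiProd {p : ℕ} (hp : p.Prime) {χ : MulChar F R} (hχ : orderOf χ = p)
    {ψ : AddChar F R} (hψ : ψ.IsPrimitive) : gaussSum χ ψ ^ p = jacobiProd p χ := by
  subst hχ
  exact gaussSum_pow_eq_prod_jacobiSum hp.two_le hψ

/-- A character of order dividing `p` takes its values in any subring that contains the `p`-th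
roots of unity. -/
theorem exists_ringHomComp_eq {S : Type*} [CommRing S] [IsDomain S] {g : S →+* R}
    (hg : Function.Injective g) {p : ℕ} [Fact p.Prime] {ζ : S} (hζ : IsPrimitiveRoot ζ p)
    {χ : MulChar F R} (hχ : χ ^ p = 1) (hp : p ∣ Fintype.card F - 1) :
    ∃ χ₀ : MulChar F S, χ₀.ringHomComp g = χ := by
  classical
  have hcard : Fintype.card Fˣ = Fintype.card F - 1 := Fintype.card_units F
  have hp0 := (Fact.out : p.Prime)
  have : NeZero p := ⟨hp0.ne_zero⟩
  obtain ⟨γ, hγ⟩ := IsCyclic.exists_generator (α := Fˣ)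
  obtain ⟨k, -, hk⟩ := MulChar.exists_apply_eq_pow hχ (hζ.map_of_injective hg) γ.ne_zero
  have hunit : IsUnit ζ := hζ.isUnit hp0.ne_zero
  have hmem : hunit.unit ^ k ∈ rootsOfUnity (Fintype.card Fˣ) S := by
    obtain ⟨m, hm⟩ := hp
    rw [mem_rootsOfUnity, hcard, hm, ← pow_mul, mul_comm, mul_assoc, pow_mul]
    have : hunit.unit ^ p = 1 := by
      ext
      simpa using hζ.pow_eq_one
    rw [this, one_pow]
  refine ⟨MulChar.ofRootOfUnity hmem hγ, (MulChar.eq_iff hγ _ _).2 ?_⟩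
  rw [MulChar.ringHomComp_apply, MulChar.ofRootOfUnity_spec, hk]
  simp

end Characters

theorem dvd_of_algebraMap_dvd {K L : Type*} [Field K] [NumberField K] [Field L] [NumberField L]
    [Algebra K L] {a b : 𝓞 K} (h : algebraMap (𝓞 K) (𝓞 L) a ∣ algebraMap (𝓞 K) (𝓞 L) b) :
    a ∣ b := by
  rcases eq_or_ne a 0 with rfl | ha
  · rw [map_zero, zero_dvd_iff] at h
    rw [zero_dvd_iff]
    exact (FaithfulSMul.algebraMap_injective (𝓞 K) (𝓞 L)) (by rw [h, map_zero])
  obtain ⟨d, hd⟩ := h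
  have haK : (algebraMap (𝓞 K) K a) ≠ 0 := RingOfIntegers.coe_ne_zero_iff.2 ha
  have h1 : algebraMap K L (algebraMap (𝓞 K) K b / algebraMap (𝓞 K) K a)
      = algebraMap (𝓞 L) L d := by
    have h2 := congrArg (algebraMap (𝓞 L) L) hd
    rw [map_mul, ← IsScalarTower.algebraMap_apply, ← IsScalarTower.algebraMap_apply,
      IsScalarTower.algebraMap_apply (𝓞 K) K L, IsScalarTower.algebraMap_apply (𝓞 K) K L] at h2
    rw [map_div₀, h2]
    exact mul_div_cancel_left₀ _ ((map_ne_zero _).2 haK)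
  have h3 : IsIntegral ℤ (algebraMap (𝓞 K) K b / algebraMap (𝓞 K) K a) := by
    have : IsIntegral ℤ (algebraMap K L (algebraMap (𝓞 K) K b / algebraMap (𝓞 K) K a)) := by
      rw [h1]
      exact RingOfIntegers.isIntegral_coe d
    exact (isIntegral_algebraMap_iff (algebraMap K L).injective).1 this
  refine ⟨⟨_, h3⟩, ?_⟩
  apply RingOfIntegers.coe_injective
  change algebraMap (𝓞 K) K b = algebraMap (𝓞 K) K a * _
  exact (mul_div_cancel₀ _ haK).symm

section Element

open IsCyclotomicExtension.Rat

variable {p : ℕ} [Fact p.Prime] {K : Type*} [Field K] [NumberField K]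
  [IsCyclotomicExtension {p} ℚ K] {q : ℕ} [Fact q.Prime]

/-- The `p`-th power `y` of the Gauss sum of the inverse of the `p`-th power residue character
modulo a prime ideal. The valuations of its conjugates come from Stickelberger's theorem, its
absolute values from the absolute value of a Gauss sum, and it is congruent to `-1` modulo
`(ζ - 1) ^ p`, to a precision governed by the residue character of `p`. -/
theorem exists_stickelberger_element (hodd : Odd p) {ζ : K} (hζ : IsPrimitiveRoot ζ p)
    (hqp : q.Coprime p) {F R κ Γ₀ : Type*} [Field F] [Fintype F] [Algebra (ZMod q) F] [CommRing R]
    [IsDomain R] [Field κ] [LinearOrderedCommGroupWithZero Γ₀] [Algebra (𝓞 K) R]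
    (hinj : Function.Injective (algebraMap (𝓞 K) R))
    (hdvd : ∀ a b : 𝓞 K, algebraMap (𝓞 K) R a ∣ algebraMap (𝓞 K) R b → a ∣ b)
    (w : Valuation R Γ₀) (hw : ∀ r, w r ≤ 1) (hw0 : ∀ r, w r = 0 → r = 0)
    (red : R →+* κ) (hred : ∀ r, red r = 0 ↔ w r < 1) (ι : F →+* κ)
    {η : R} (hη : IsPrimitiveRoot η (Fintype.card F - 1)) {ξ : R} (hξ : IsPrimitiveRoot ξ q)
    {f : ℕ} (hf : Fintype.card F = q ^ f) {E : ℕ} (hE : p * E = q ^ f - 1) :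
    ∃ y : 𝓞 K,
      (∀ t : (ZMod p)ˣ, w (algebraMap (𝓞 K) R (galOf K t • y)) =
        w (q : R) ^ ∑ i ∈ Finset.range f, (t : ZMod p).val * q ^ i % p) ∧
      y * galOf K (-1 : (ZMod p)ˣ) • y = ((q ^ f : ℕ) : 𝓞 K) ^ p ∧
      ∃ c : 𝓞 K, (hζ.toInteger - 1) ^ (p + 1) ∣ y + 1 - c * (hζ.toInteger - 1) ^ p ∧
        (hζ.toInteger - 1 ∣ c ↔ (p : F) ^ E = 1) := by
  have hp := (Fact.out : p.Prime)
  have hq := (Fact.out : q.Prime)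
  have hζi := hζ.toInteger_isPrimitiveRoot
  set ζ' := hζ.toInteger with hζ'
  set g := algebraMap (𝓞 K) R with hg
  obtain ⟨ω, hω⟩ := exists_teichmuller red ι hη
  have hchar : CharP F q := (Algebra.charP_iff (ZMod q) F q).1 inferInstance
  have hN0 : 0 < q ^ f - 1 := by
    have := Fintype.one_lt_card (α := F)
    omega
  have hE0 : 0 < E := Nat.pos_of_ne_zero fun h ↦ by rw [h] at hE; omega
  set χ : MulChar F R := (ω⁻¹) ^ E with hχdef
  have hχp : χ ^ p = 1 := by
    rw [hχdef, ← pow_mul, mul_comm, hE]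
    exact inv_pow_card_sub_one ω hf
  have hEN : E < q ^ f - 1 := by
    rw [← hE]
    exact lt_mul_of_one_lt_left hE0 hp.one_lt
  have hχ1 : χ ≠ 1 := inv_pow_ne_one_of_reduction red ι ω hω hf hE0.ne' hEN
  have hχord : orderOf χ = p := orderOf_eq_prime hχp hχ1
  have hχt : ∀ t : (ZMod p)ˣ, orderOf (χ ^ (t : ZMod p).val) = p := by
    intro t
    rw [Nat.Coprime.orderOf_pow, hχord]
    rw [hχord]
    exact (ZMod.val_coe_unit_coprime t).symm
  have hψ := traceChar_isPrimitive (F := F) hξ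
  set ψ := traceChar (F := F) q hξ.pow_eq_one with hψdef
  obtain ⟨χ₀, hχ₀⟩ := exists_ringHomComp_eq (p := p) hinj hζi hχp
    (by rw [hf, ← hE]; exact Dvd.intro _ rfl)
  have hχ₀p : ∀ x : F, x ≠ 0 → χ₀ x ^ p = 1 := by
    intro x hx
    apply hinj
    rw [map_pow, map_one, ← MulChar.ringHomComp_apply, hχ₀, ← MulChar.pow_apply' _ hp.ne_zero,
      hχp, MulChar.one_apply (isUnit_iff_ne_zero.2 hx)]
  have hconj : ∀ t : (ZMod p)ˣ,
      g (galOf K t • jacobiProd p χ₀) = gaussSum (χ ^ (t : ZMod p).val) ψ ^ p := by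
    intro t
    rw [gaussSum_pow_eq_jacobiProd hp (hχt t) hψ, ← hχ₀, MulChar.ringHomComp_pow,
      ← map_jacobiProd]
    congr 1
    change MulSemiringAction.toRingHom _ (𝓞 K) (galOf K t) _ = _
    rw [map_jacobiProd]
    congr 1
    refine MulChar.ext fun x ↦ ?_
    rw [MulChar.ringHomComp_apply, MulChar.pow_apply_coe]
    exact galOf_smul_of_pow_eq_one t (hχ₀p x x.ne_zero)
  refine ⟨jacobiProd p χ₀, fun t ↦ ?_, ?_, ?_⟩
  · have ht := ZMod.val_lt (t : ZMod p)
    have hlt : (t : ZMod p).val * E < q ^ f - 1 := by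
      rw [← hE]
      exact (Nat.mul_lt_mul_right hE0).2 ht
    rw [hconj, map_pow, hχdef, ← pow_mul, mul_comm E,
      valuation_gaussSum w hw hw0 red hred ι ω hω hξ hf _ hlt, valuation_natCast_prime w hw hξ,
      ← pow_mul, ← pow_mul, mul_comm _ p, mul_sum_digits hq.one_lt hp.pos ht hE]
  · apply hinj
    have h1 : jacobiProd p χ₀ = galOf K (1 : (ZMod p)ˣ) • jacobiProd p χ₀ := by
      rw [galOf, map_one, one_smul]
    have h2 : ((-1 : (ZMod p)ˣ) : ZMod p).val = orderOf χ - 1 := by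
      have : NeZero (1 : ZMod p) := ⟨one_ne_zero⟩
      rw [hχord, Units.val_neg, Units.val_one, ZMod.val_neg_of_ne_zero, ZMod.val_one]
    rw [map_mul]
    nth_rw 1 [h1]
    change g _ * g _ = _
    rw [hconj, hconj, ← mul_pow, Units.val_one, ZMod.val_one, pow_one, h2,
      gaussSum_mul_gaussSum_pow_orderOf_sub_one hχ1 hψ, mul_pow, ← MulChar.pow_apply' _ hp.ne_zero,
      hχp, MulChar.one_apply isUnit_one.neg, one_mul, hf, map_pow, map_natCast]
  · have hprime : Prime (ζ' - 1) := hζ.zeta_sub_one_prime'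
    have hζR : IsPrimitiveRoot (g ζ') p := hζi.map_of_injective hinj
    have hu : ¬ IsUnit (g ζ' - 1) := by
      intro h
      have h1 : g (ζ' - 1) ∣ g 1 := by
        rw [map_sub, map_one]; exact h.dvd
      exact hprime.not_isUnit (isUnit_of_dvd_one (hdvd _ _ h1))
    have hval : ∀ x ≠ 0, ∃ k : ℕ, χ₀ x = ζ' ^ k := by
      intro x hx
      obtain ⟨k, -, hk⟩ := hζi.eq_pow_of_pow_eq_one (hχ₀p x hx)
      exact ⟨k, hk.symm⟩
    have hχval : ∀ x ≠ 0, ∃ k : ℕ, χ x = g ζ' ^ k := by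
      intro x hx
      obtain ⟨k, hk⟩ := hval x hx
      exact ⟨k, by rw [← hχ₀, MulChar.ringHomComp_apply, hk, map_pow]⟩
    have hpF : (p : F) ≠ 0 := by
      rw [Ne, CharP.cast_eq_zero_iff F q]
      exact (Nat.Prime.coprime_iff_not_dvd hq).1 hqp
    have hψ1 : ψ ≠ 1 := by
      have := hψ (a := 1) one_ne_zero
      rwa [AddChar.mulShift_one] at this
    obtain ⟨c', hc', hcong⟩ := gaussSum_pow_prime_congr hζR hodd hu χ hχval hψ1 hpF
    obtain ⟨k, hk⟩ := hval _ hpF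
    obtain ⟨c, hc, hcd⟩ := root_pow_eq_one_add ζ' k
    have hcc : c' = g c := by
      have h1 : (g ζ' - 1) * c' = (g ζ' - 1) * g c := by
        have h2 : χ (p : F) = g (1 + (ζ' - 1) * c) := by
          rw [← hc, ← hk, ← hχ₀, MulChar.ringHomComp_apply]
        rw [hc', map_add, map_mul, map_sub, map_one] at h2
        exact add_left_cancel h2
      exact mul_left_cancel₀ (sub_ne_zero.2 (hζR.ne_one hp.one_lt)) h1
    refine ⟨c, hdvd _ _ ?_, ?_⟩
    · have h1 := hconj 1
      rw [Units.val_one, ZMod.val_one, pow_one, galOf, map_one, one_smul] at h1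
      change g _ ∣ g _
      rw [map_pow, map_sub, map_sub, map_mul, map_add, map_one, map_pow, map_sub, map_one, h1,
        ← hcc]
      exact hcong
    · have h1 : ζ' - 1 ∣ c ↔ χ₀ (p : F) = 1 := by
        constructor
        · intro h
          have h2 : ζ' - 1 ∣ ((k : ℤ) : 𝓞 K) := by
            have := dvd_sub h hcd
            rw [sub_sub_cancel] at this
            exact_mod_cast this
          have h3 : p ∣ k := by
            have := (zeta_sub_one_dvd_intCast_iff' p hζ).1 h2
            exact_mod_cast this
          rw [hk]
          exact (hζi.pow_eq_one_iff_dvd k).2 h3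
        · intro h
          rw [hk] at h
          rw [h] at hc
          have h2 : (ζ' - 1) * c = 0 := by linear_combination -hc
          rw [(mul_eq_zero.1 h2).resolve_left hprime.ne_zero]
          exact dvd_zero _
      have h2 : χ₀ (p : F) = 1 ↔ χ (p : F) = 1 := by
        rw [← hχ₀, MulChar.ringHomComp_apply, map_eq_one_iff g hinj]
      have h3 : χ (p : F) = ω ((p : F)⁻¹ ^ E) := by
        rw [hχdef, MulChar.pow_apply' _ hE0.ne', MulChar.inv_apply', map_pow]
      rw [h1, h2, h3]
      constructor
      · intro h
        have h4 := congrArg red h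
        rw [hω, map_one, ← map_one ι] at h4
        have h5 := ι.injective h4
        rwa [inv_pow, inv_eq_one] at h5
      · intro h
        rw [inv_pow, h, inv_one, map_one]

end Element

/-! ### Comparison of `A ^ P(σ)` with the Stickelberger element -/

section Prime

open IsCyclotomicExtension.Rat

variable {p : ℕ} [Fact p.Prime] {K : Type*} [Field K] [NumberField K]
  [IsCyclotomicExtension {p} ℚ K] {q : ℕ} [Fact q.Prime]

theorem absNorm_eq_pow_orderOf (𝔮 : Ideal (𝓞 K)) [𝔮.IsPrime] [𝔮.LiesOver (Ideal.span {(q : ℤ)})]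
    (hqp : q.Coprime p) : Ideal.absNorm 𝔮 = q ^ orderOf (q : ZMod p) := by
  rw [← Ideal.pow_inertiaDeg q 𝔮, inertiaDeg_eq_of_not_dvd (m := p) q K 𝔮
    ((Nat.Prime.coprime_iff_not_dvd (Fact.out : q.Prime)).1 hqp)]

omit [NumberField K] in
theorem liesOver_span_of_mem {𝔮 : Ideal (𝓞 K)} [𝔮.IsPrime] (h : (q : 𝓞 K) ∈ 𝔮) :
    𝔮.LiesOver (Ideal.span {(q : ℤ)}) := by
  have hmax : (Ideal.span {(q : ℤ)}).IsMaximal :=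
    Int.ideal_span_isMaximal_of_prime q
  refine ⟨hmax.eq_of_le (Ideal.IsPrime.ne_top (Ideal.IsPrime.under ℤ 𝔮)) ?_⟩
  rw [Ideal.span_singleton_le_iff_mem]
  change algebraMap ℤ (𝓞 K) q ∈ 𝔮
  simpa using h

/-- The Stickelberger element of `𝔮`, with a valuation of `K` centred at `𝔮` that is induced from
the field of the `q (q ^ f - 1)`-th roots of unity over `K`. -/
theorem exists_stickelberger_element_of_isMaximal (hodd : Odd p) {ζ : K} (hζ : IsPrimitiveRoot ζ p)
    (𝔮 : Ideal (𝓞 K)) [𝔮.IsMaximal] [𝔮.LiesOver (Ideal.span {(q : ℤ)})] (hqp : q.Coprime p)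
    {E : ℕ} (hE : p * E = q ^ orderOf (q : ZMod p) - 1) :
    ∃ (w : Valuation (𝓞 K) (WithZero (Multiplicative ℤ))) (y : 𝓞 K),
      (∀ r, r ∉ 𝔮 → w r = 1) ∧ (∀ r ∈ 𝔮, w r < 1) ∧ (∀ r, w r = 0 → r = 0) ∧
      (∀ t : (ZMod p)ˣ, w (galOf K t • y) =
        w (q : 𝓞 K) ^ ∑ i ∈ Finset.range (orderOf (q : ZMod p)), (t : ZMod p).val * q ^ i % p) ∧
      y * galOf K (-1 : (ZMod p)ˣ) • y = ((q ^ orderOf (q : ZMod p) : ℕ) : 𝓞 K) ^ p ∧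
      ∃ c : 𝓞 K, (hζ.toInteger - 1) ^ (p + 1) ∣ y + 1 - c * (hζ.toInteger - 1) ^ p ∧
        (hζ.toInteger - 1 ∣ c ↔ (p : 𝓞 K) ^ E - 1 ∈ 𝔮) := by
  have hq := (Fact.out : q.Prime)
  set f := orderOf (q : ZMod p) with hfdef
  let : Field (𝓞 K ⧸ 𝔮) := Ideal.Quotient.field 𝔮
  have hq𝔮 : (q : 𝓞 K) ∈ 𝔮 := by
    have h : (q : ℤ) ∈ Ideal.under ℤ 𝔮 := by
      rw [← Ideal.over_def 𝔮 (Ideal.span {(q : ℤ)})]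
      exact Ideal.mem_span_singleton_self _
    have h2 : algebraMap ℤ (𝓞 K) q ∈ 𝔮 := h
    simpa using h2
  have h𝔮0 : 𝔮 ≠ ⊥ := by
    rintro rfl
    exact hq.ne_zero (by exact_mod_cast (Ideal.mem_bot.1 hq𝔮))
  have : Finite (𝓞 K ⧸ 𝔮) := Ring.HasFiniteQuotients.finiteQuotient h𝔮0
  let : Fintype (𝓞 K ⧸ 𝔮) := Fintype.ofFinite _
  have : CharP (𝓞 K ⧸ 𝔮) q := by
    rw [CharP.charP_iff_prime_eq_zero hq, ← map_natCast (Ideal.Quotient.mk 𝔮)]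
    exact Ideal.Quotient.eq_zero_iff_mem.2 hq𝔮
  let : Algebra (ZMod q) (𝓞 K ⧸ 𝔮) := ZMod.algebra _ q
  have hcard : Fintype.card (𝓞 K ⧸ 𝔮) = q ^ f := by
    rw [← absNorm_eq_pow_orderOf 𝔮 hqp, Ideal.absNorm_apply, Submodule.cardQuot_apply,
      Nat.card_eq_fintype_card]
  have hN0 : 0 < q ^ f - 1 := by
    have := Fintype.one_lt_card (α := 𝓞 K ⧸ 𝔮)
    omega
  have : NeZero (q * (q ^ f - 1)) := ⟨(Nat.mul_pos hq.pos hN0).ne'⟩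
  -- `L` holds the values of the additive character (order `q`) and of the Teichmüller character.
  let L := CyclotomicField (q * (q ^ f - 1)) K
  have hz : IsPrimitiveRoot (IsCyclotomicExtension.zeta (q * (q ^ f - 1)) K L)
    (q * (q ^ f - 1)) := IsCyclotomicExtension.zeta_spec _ K L
  have hzi := hz.toInteger_isPrimitiveRoot
  have hη := hzi.pow (NeZero.pos _)
    (show q * (q ^ f - 1) = q * (Fintype.card (𝓞 K ⧸ 𝔮) - 1) by rw [hcard])
  have hξ := hzi.pow (NeZero.pos _) (mul_comm _ _)
  obtain ⟨𝔓, -, h𝔓, hcomap⟩ := Ideal.exists_ideal_over_prime_of_isIntegral (S := 𝓞 L) 𝔮 ⊥ (by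
    intro x hx
    have hx0 : algebraMap (𝓞 K) (𝓞 L) x = 0 := hx
    rw [(map_eq_zero_iff _ (FaithfulSMul.algebraMap_injective (𝓞 K) (𝓞 L))).1 hx0]
    exact 𝔮.zero_mem)
  have h𝔓0 : 𝔓 ≠ ⊥ := by
    rintro rfl
    have h1 : (q : 𝓞 K) ∈ Ideal.comap (algebraMap (𝓞 K) (𝓞 L)) ⊥ := hcomap ▸ hq𝔮
    have h2 : algebraMap (𝓞 K) (𝓞 L) (q : 𝓞 K) = 0 := h1
    rw [map_natCast] at h2
    exact hq.ne_zero (by exact_mod_cast h2)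
  have : 𝔓.IsMaximal := h𝔓.isMaximal h𝔓0
  let : Field (𝓞 L ⧸ 𝔓) := Ideal.Quotient.field 𝔓
  let V : IsDedekindDomain.HeightOneSpectrum (𝓞 L) := ⟨𝔓, h𝔓, h𝔓0⟩
  have hmem : ∀ r : 𝓞 K, algebraMap (𝓞 K) (𝓞 L) r ∈ 𝔓 ↔ r ∈ 𝔮 := fun r ↦ by
    rw [← hcomap, Ideal.mem_comap]
  obtain ⟨y, hy1, hy2, c, hc1, hc2⟩ := exists_stickelberger_element (q := q) hodd hζ hqp
    (F := 𝓞 K ⧸ 𝔮) (R := 𝓞 L) (κ := 𝓞 L ⧸ 𝔓)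
    (FaithfulSMul.algebraMap_injective (𝓞 K) (𝓞 L)) (fun a b h ↦ dvd_of_algebraMap_dvd h)
    V.intValuation V.intValuation_le_one
    (fun r hr ↦ by_contra fun h ↦ V.intValuation_ne_zero r h hr) (Ideal.Quotient.mk 𝔓)
    (fun r ↦ Ideal.Quotient.eq_zero_iff_mem.trans (V.intValuation_lt_one_iff_mem r).symm)
    (Ideal.quotientMap 𝔓 (algebraMap (𝓞 K) (𝓞 L)) hcomap.ge) hη hξ hcard hE
  refine ⟨V.intValuation.comap (algebraMap (𝓞 K) (𝓞 L)), y, fun r hr ↦ ?_, fun r hr ↦ ?_,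
    fun r hr ↦ ?_, fun t ↦ ?_, hy2, c, hc1, hc2.trans ?_⟩
  · exact (V.intValuation_eq_one_iff_mem_primeCompl _).2 fun h ↦ hr ((hmem r).1 h)
  · exact (V.intValuation_lt_one_iff_mem _).2 ((hmem r).2 hr)
  · by_contra h
    exact V.intValuation_ne_zero _
      ((map_ne_zero_iff _ (FaithfulSMul.algebraMap_injective (𝓞 K) (𝓞 L))).2 h) hr
  · have := hy1 t
    rw [Valuation.comap_apply, Valuation.comap_apply, map_natCast]
    exact this
  · rw [← Ideal.Quotient.eq, map_pow, map_natCast, map_one]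

/-- The ideals generated by `A ^ P(σ)` and `y ^ p` have the same prime factorization. -/
theorem associated_prod_pow (𝔮 : Ideal (𝓞 K)) [𝔮.IsMaximal] [𝔮.LiesOver (Ideal.span {(q : ℤ)})]
    (hqp : q.Coprime p) {A : 𝓞 K} (hA : Ideal.span {A} = 𝔮 ^ p)
    (w : Valuation (𝓞 K) (WithZero (Multiplicative ℤ))) (hw1 : ∀ r, r ∉ 𝔮 → w r = 1)
    (hw2 : ∀ r ∈ 𝔮, w r < 1) (hw0 : ∀ r, w r = 0 → r = 0) {y : 𝓞 K}
    (hy : ∀ t : (ZMod p)ˣ, w (galOf K t • y) =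
        w (q : 𝓞 K) ^ ∑ i ∈ Finset.range (orderOf (q : ZMod p)), (t : ZMod p).val * q ^ i % p)
    {m : ℕ} (hym : y ∣ (q : 𝓞 K) ^ m) :
    Associated (y ^ p)
      (∏ u : (ZMod p)ˣ, (galOf K u • A) ^ ((u⁻¹ : (ZMod p)ˣ) : ZMod p).val) := by
  have hq0 : (q : 𝓞 K) ≠ 0 := by exact_mod_cast (Fact.out : q.Prime).ne_zero
  obtain ⟨𝔟, h𝔟, -⟩ := exists_span_eq_mul_of_coprime 𝔮 hqp
  have hAq : A ∣ (q : 𝓞 K) ^ p := by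
    have h1 : Ideal.span {(q : 𝓞 K) ^ p} = Ideal.span {A} * 𝔟 ^ p := by
      rw [← Ideal.span_singleton_pow, h𝔟, mul_pow, hA]
    rw [← Ideal.mem_span_singleton]
    exact (h1.le.trans Ideal.mul_le_left) (Ideal.mem_span_singleton_self _)
  have hgal : ∀ u : (ZMod p)ˣ, galOf K u • A ∣ (q : 𝓞 K) ^ p := by
    intro u
    have h1 := map_dvd (MulSemiringAction.toRingHom _ (𝓞 K) (galOf K u)) hAq
    rwa [map_pow, map_natCast] at h1
  set B := ∏ u : (ZMod p)ˣ, (galOf K u • A) ^ ((u⁻¹ : (ZMod p)ˣ) : ZMod p).val with hB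
  have hB0 : B ≠ 0 := by
    rw [hB, Finset.prod_ne_zero_iff]
    intro u _
    exact pow_ne_zero _ (ne_zero_of_dvd_ne_zero (pow_ne_zero _ hq0) (hgal u))
  have hy0 : y ≠ 0 := ne_zero_of_dvd_ne_zero (pow_ne_zero _ hq0) hym
  have key : ∀ P : Ideal (𝓞 K), P.IsMaximal →
      ∃ v : Valuation (𝓞 K) (WithZero (Multiplicative ℤ)), (∀ r, r ∉ P → v r = 1) ∧
      (∀ r ∈ P, v r < 1) ∧ v (y ^ p) = v B ∧ v B ≠ 0 := by
    intro P hP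
    have hPp := hP.isPrime
    by_cases hqP : (q : 𝓞 K) ∈ P
    · have := liesOver_span_of_mem hqP
      obtain ⟨t, ht⟩ := exists_galOf_smul_eq (p := p) (q := q) 𝔮 P
      refine ⟨w.comap (MulSemiringAction.toRingHom _ (𝓞 K) (galOf K t)),
        fun r hr ↦ hw1 _ fun h ↦ hr ((ht r).2 h), fun r hr ↦ hw2 _ ((ht r).1 hr), ?_, ?_⟩
      · rw [map_pow, Valuation.comap_apply, Valuation.comap_apply]
        refine Eq.trans ?_ (valuation_galOf_smul_prod 𝔮 hqp w hw1 hA t).symm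
        rw [mul_comm p, pow_mul]
        exact congrArg (· ^ p) (hy t)
      · rw [Valuation.comap_apply]
        refine fun h ↦ pow_ne_zero _ (fun h ↦ hq0 (hw0 _ h))
          ((valuation_galOf_smul_prod 𝔮 hqp w hw1 hA t).symm.trans h)
    · have hPbot : P ≠ ⊥ := by
        rintro rfl
        exact RingOfIntegers.not_isField K (Ring.isField_iff_maximal_bot.2 hP)
      let V : IsDedekindDomain.HeightOneSpectrum (𝓞 K) := ⟨P, hPp, hPbot⟩
      have hnot : ∀ r, r ∉ P → V.intValuation r = 1 :=
        fun r hr ↦ (V.intValuation_eq_one_iff_mem_primeCompl _).2 hr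
      have hnmem : ∀ x n, x ∣ (q : 𝓞 K) ^ n → x ∉ P := fun x n hx hxP ↦
        hqP (hPp.mem_of_pow_mem n (P.mem_of_dvd hx hxP))
      have h1 : V.intValuation (y ^ p) = 1 := by
        rw [map_pow, hnot y (hnmem y _ hym), one_pow]
      have h2 : V.intValuation B = 1 := by
        rw [hB, map_prod]
        refine Finset.prod_eq_one fun u _ ↦ ?_
        rw [map_pow, hnot _ (hnmem _ _ (hgal u)), one_pow]
      exact ⟨V.intValuation, hnot, fun r hr ↦ (V.intValuation_lt_one_iff_mem _).2 hr,
        h1.trans h2.symm, by rw [h2]; exact one_ne_zero⟩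
  refine associated_of_dvd_dvd (dvd_of_valuations_eq key (pow_ne_zero _ hy0))
    (dvd_of_valuations_eq (Γ₀ := WithZero (Multiplicative ℤ)) (fun P hP ↦ ?_) hB0)
  obtain ⟨v, h1, h2, h3, h4⟩ := key P hP
  exact ⟨v, h1, h2, h3.symm, h3 ▸ h4⟩

/-- The unit relating `A ^ P(σ)` and `y ^ p` has all its absolute values equal to `1`. -/
theorem norm_embedding_eq_one {𝔮 : Ideal (𝓞 K)} {A : 𝓞 K}
    (hA : Ideal.span {A} = 𝔮 ^ p) {y u : 𝓞 K} (h𝔮 : Ideal.absNorm 𝔮 ≠ 0)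
    (hyc : y * galOf K (-1 : (ZMod p)ˣ) • y = ((Ideal.absNorm 𝔮 : ℕ) : 𝓞 K) ^ p)
    (hu : y ^ p * u = ∏ u : (ZMod p)ˣ, (galOf K u • A) ^ ((u⁻¹ : (ZMod p)ˣ) : ZMod p).val)
    (φ : K →+* ℂ) : ‖φ (u : K)‖ = 1 := by
  have hconj : ∀ x : 𝓞 K, ‖φ ((x * galOf K (-1 : (ZMod p)ˣ) • x : 𝓞 K) : K)‖ = ‖φ x‖ ^ 2 := by
    intro x
    rw [RingOfIntegers.coe_eq_algebraMap, map_mul, map_mul]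
    change ‖φ x * φ (galOf K (-1 : (ZMod p)ˣ) (x : K))‖ = _
    rw [embedding_galOf_neg_one, norm_mul, RCLike.norm_conj, sq]
  have h1 := hconj (∏ u : (ZMod p)ˣ, (galOf K u • A) ^ ((u⁻¹ : (ZMod p)ˣ) : ZMod p).val)
  rw [prod_mul_galOf_neg_one_smul, RingOfIntegers.coe_eq_algebraMap, map_pow, map_pow, norm_pow,
    ← RingOfIntegers.coe_eq_algebraMap, norm_embedding_prod_galOf_smul hA φ, ← hu] at h1
  have h2 := hconj y
  rw [hyc, RingOfIntegers.coe_eq_algebraMap, map_pow, map_pow, map_natCast, map_natCast,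
    norm_pow, Complex.norm_natCast] at h2
  rw [RingOfIntegers.coe_eq_algebraMap, map_mul, map_mul, map_pow (algebraMap (𝓞 K) K), map_pow φ,
    norm_mul, norm_pow,
    mul_pow, pow_right_comm, ← RingOfIntegers.coe_eq_algebraMap, ← h2, map_pow, Nat.cast_pow] at h1
  have h3 : (((Ideal.absNorm 𝔮 : ℕ) : ℝ) ^ p) ^ p ≠ 0 := by
    have : ((Ideal.absNorm 𝔮 : ℕ) : ℝ) ≠ 0 := by exact_mod_cast h𝔮
    positivity
  have h4 : ‖φ (u : K)‖ ^ 2 = 1 := by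
    have := h1.symm
    rwa [mul_eq_left₀ h3] at this
  exact (pow_eq_one_iff_of_nonneg (norm_nonneg _) two_ne_zero).1 h4

end Prime

/-! ### Congruences for `A ^ P(σ)` -/

section Congruence

open IsCyclotomicExtension.Rat

variable {p : ℕ} [Fact p.Prime] {K : Type*} [Field K] [NumberField K]
  [IsCyclotomicExtension {p} ℚ K]

omit [NumberField K] [IsCyclotomicExtension {p} ℚ K] in
theorem sub_one_sq_dvd_prime (hp2 : 2 < p) {ζ : K} (hζ : IsPrimitiveRoot ζ p) :
    (hζ.toInteger - 1) ^ 2 ∣ (p : 𝓞 K) := by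
  obtain ⟨r, hr⟩ := exists_prime_eq hζ.toInteger_isPrimitiveRoot
  rw [hr]
  exact dvd_add ((dvd_neg).2 (pow_dvd_pow _ (by omega))) ((pow_dvd_pow _ (by omega)).mul_right _)

/-- A `p`-th root of unity that is congruent to a rational integer modulo `(ζ - 1) ^ 2` is `1`. -/
theorem root_pow_eq_one_of_congr_intCast (hp2 : 2 < p) {ζ : K} (hζ : IsPrimitiveRoot ζ p) {k : ℕ}
    {m : ℤ} (h : (hζ.toInteger - 1) ^ 2 ∣ hζ.toInteger ^ k - (m : 𝓞 K)) :
    hζ.toInteger ^ k = 1 := by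
  have hprime : Prime (hζ.toInteger - 1) := hζ.zeta_sub_one_prime'
  obtain ⟨c, hc, hcd⟩ := root_pow_eq_one_add hζ.toInteger k
  have h1 : hζ.toInteger - 1 ∣ ((1 - m : ℤ) : 𝓞 K) := by
    have h2 := dvd_sub ((dvd_pow_self _ two_ne_zero).trans h)
      (sub_one_dvd_pow_sub_one hζ.toInteger k)
    push_cast
    rwa [sub_sub_sub_cancel_left] at h2
  have h2 : (hζ.toInteger - 1) ^ 2 ∣ ((1 - m : ℤ) : 𝓞 K) := by
    obtain ⟨e, he⟩ := (zeta_sub_one_dvd_intCast_iff' p hζ).1 h1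
    rw [he]
    push_cast
    exact (sub_one_sq_dvd_prime hp2 hζ).mul_right _
  have h3 : (hζ.toInteger - 1) ^ 2 ∣ (hζ.toInteger - 1) * c := by
    have := dvd_sub h h2
    rw [hc] at this
    push_cast at this
    convert this using 1
    ring
  rw [sq] at h3
  have h4 := (mul_dvd_mul_iff_left hprime.ne_zero).1 h3
  have h5 : hζ.toInteger - 1 ∣ ((k : ℤ) : 𝓞 K) := by
    have := dvd_sub h4 hcd
    rw [sub_sub_cancel] at this
    exact_mod_cast this
  have h6 := (zeta_sub_one_dvd_intCast_iff' p hζ).1 h5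
  exact (hζ.toInteger_isPrimitiveRoot.pow_eq_one_iff_dvd k).2 (by exact_mod_cast h6)

theorem exists_intCast_congr_prod {ζ : K} (hζ : IsPrimitiveRoot ζ p) {A : 𝓞 K} {a : ℤ}
    (ha : (hζ.toInteger - 1) ^ 2 ∣ A - (a : 𝓞 K)) :
    ∃ m : ℤ, (hζ.toInteger - 1) ^ 2 ∣
      (∏ u : (ZMod p)ˣ, (galOf K u • A) ^ ((u⁻¹ : (ZMod p)ˣ) : ZMod p).val) - (m : 𝓞 K) := by
  set I := Ideal.span {(hζ.toInteger - 1) ^ 2}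
  refine ⟨∏ u : (ZMod p)ˣ, a ^ ((u⁻¹ : (ZMod p)ˣ) : ZMod p).val, ?_⟩
  rw [← Ideal.mem_span_singleton, ← Ideal.Quotient.eq, map_prod, map_intCast, Int.cast_prod]
  refine Finset.prod_congr rfl fun u _ ↦ ?_
  rw [map_pow, Int.cast_pow]
  congr 1
  rw [← map_intCast (Ideal.Quotient.mk I), Ideal.Quotient.eq, Ideal.mem_span_singleton]
  have h1 := map_dvd (MulSemiringAction.toRingHom _ (𝓞 K) (galOf K u)) ha
  rw [map_pow, map_sub, map_sub, map_one, map_intCast] at h1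
  refine Dvd.dvd.trans (pow_dvd_pow_of_dvd ?_ 2) h1
  change hζ.toInteger - 1 ∣ galOf K u • hζ.toInteger - 1
  rw [galOf_smul_of_pow_eq_one u hζ.toInteger_isPrimitiveRoot.pow_eq_one]
  exact sub_one_dvd_pow_sub_one _ _

/-- By Kronecker's theorem the unit `u` is `± ζ ^ r`, and the congruences modulo `(ζ - 1) ^ 2` force
`ζ ^ r = 1`. -/
theorem eq_or_eq_neg_of_congr (hodd : Odd p) (hp2 : 2 < p) {ζ : K} (hζ : IsPrimitiveRoot ζ p)
    {y u B : 𝓞 K} (hu : y ^ p * u = B) (hunit : ∀ φ : K →+* ℂ, ‖φ (u : K)‖ = 1) {m : ℤ}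
    (hB : (hζ.toInteger - 1) ^ 2 ∣ B - (m : 𝓞 K)) (hy : (hζ.toInteger - 1) ^ 2 ∣ y ^ p + 1) :
    B = y ^ p ∨ B = -y ^ p := by
  obtain ⟨N, hN, hpow⟩ := Embeddings.pow_eq_one_of_norm_eq_one K ℂ (RingOfIntegers.isIntegral_coe u)
    hunit
  obtain ⟨r, -, hr⟩ := hζ.exists_pow_or_neg_mul_pow_of_isOfFinOrder hodd
    (isOfFinOrder_iff_pow_eq_one.2 ⟨N, hN, hpow⟩)
  have hr' : u = hζ.toInteger ^ r ∨ u = -hζ.toInteger ^ r := by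
    rcases hr with h | h
    · refine Or.inl (RingOfIntegers.coe_injective (h.trans ?_))
      rw [map_pow]
      rfl
    · refine Or.inr (RingOfIntegers.coe_injective (h.trans ?_))
      rw [map_neg, map_pow]
      rfl
  have hcong : (hζ.toInteger - 1) ^ 2 ∣ u + (m : 𝓞 K) := by
    have h1 := dvd_sub (hy.mul_right u) hB
    rw [← hu] at h1
    convert h1 using 1
    ring
  rcases hr' with h | h
  · have h1 := root_pow_eq_one_of_congr_intCast hp2 hζ (k := r) (m := -m)
      (by rw [h] at hcong; push_cast; rwa [sub_neg_eq_add])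
    left
    rw [← hu, h, h1, mul_one]
  · have h1 := root_pow_eq_one_of_congr_intCast hp2 hζ (k := r) (m := m) (by
      rw [h] at hcong
      rw [← dvd_neg]
      convert hcong using 1
      ring)
    right
    rw [← hu, h, h1, mul_neg, mul_one]

omit [NumberField K] [IsCyclotomicExtension {p} ℚ K] in
/-- If `q ≡ 1 mod p`, then `𝔮` has degree one and the condition can be read modulo `q`. Otherwise
`q - 1` is prime to `p`, so it divides `E` and the condition holds by Fermat's theorem. -/
theorem prime_pow_sub_one_mem_iff {q : ℕ} [Fact q.Prime] (𝔮 : Ideal (𝓞 K)) [𝔮.IsPrime]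
    (hq𝔮 : (q : 𝓞 K) ∈ 𝔮) (hqp : q.Coprime p) {E : ℕ}
    (hE : p * E = q ^ orderOf (q : ZMod p) - 1) :
    (p : 𝓞 K) ^ E - 1 ∈ 𝔮 ↔ (q ≡ 1 [MOD p] → p ^ ((q - 1) / p) ≡ 1 [MOD q]) := by
  have hp := (Fact.out : p.Prime)
  have hq := (Fact.out : q.Prime)
  have hmem : (p : 𝓞 K) ^ E - 1 ∈ 𝔮 ↔ p ^ E ≡ 1 [MOD q] := by
    have hover := liesOver_span_of_mem (q := q) hq𝔮
    have h1 : (p : 𝓞 K) ^ E - 1 ∈ 𝔮 ↔ ((p : ℤ) ^ E - 1) ∈ Ideal.span {(q : ℤ)} := by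
      rw [Ideal.over_def 𝔮 (Ideal.span {(q : ℤ)}), Ideal.under, Ideal.mem_comap]
      simp
    rw [h1, Ideal.mem_span_singleton, Nat.ModEq.comm, Nat.modEq_iff_dvd]
    push_cast
    rfl
  rw [hmem]
  have hone : (q : ZMod p) = 1 ↔ q ≡ 1 [MOD p] := by
    rw [← ZMod.natCast_eq_natCast_iff, Nat.cast_one]
  by_cases h : q ≡ 1 [MOD p]
  · have hE' : E = (q - 1) / p := by
      rw [hone.2 h, orderOf_one, pow_one] at hE
      rw [← hE, Nat.mul_div_cancel_left _ hp.pos]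
    simp [h, hE']
  · simp only [h, false_imp_iff, iff_true]
    have h1 : q - 1 ∣ p * E := by
      rw [hE]
      exact Nat.sub_one_dvd_pow_sub_one q _
    have h2 : (q - 1).Coprime p := by
      rw [Nat.coprime_comm, hp.coprime_iff_not_dvd]
      intro hd
      exact h ((Nat.modEq_iff_dvd' hq.one_lt.le).2 hd).symm
    obtain ⟨d, rfl⟩ := h2.dvd_of_dvd_mul_left h1
    have h3 := Nat.ModEq.pow_totient hqp.symm
    rw [Nat.totient_prime hq] at h3
    have h4 := h3.pow d
    rwa [one_pow, ← pow_mul] at h4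

/-- If `q = p`, then `ζ - 1` lies in `𝔮`, hence so does `a`; but `a` and `p` generate `1`. -/
theorem coprime_of_span_eq_pow {ζ : K} (hζ : IsPrimitiveRoot ζ p) {q : ℕ} [Fact q.Prime]
    {𝔮 : Ideal (𝓞 K)} [h𝔮 : 𝔮.IsPrime] {A : 𝓞 K} {a : ℤ} (hpa : ¬ (p : ℤ) ∣ a)
    (ha : hζ.toInteger - 1 ∣ A - (a : 𝓞 K)) (hq𝔮 : (q : 𝓞 K) ∈ 𝔮)
    (hA : Ideal.span {A} = 𝔮 ^ p) : q.Coprime p := by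
  have hp := (Fact.out : p.Prime)
  rw [Nat.coprime_primes (Fact.out : q.Prime) hp]
  rintro rfl
  have hl : hζ.toInteger - 1 ∈ 𝔮 :=
    h𝔮.mem_of_pow_mem _ (𝔮.mem_of_dvd (associated_zeta_sub_one_pow_prime q hζ).symm.dvd hq𝔮)
  have hA1 : A ∈ 𝔮 :=
    Ideal.pow_le_self hp.ne_zero (hA ▸ Ideal.mem_span_singleton_self A : A ∈ 𝔮 ^ q)
  have ha1 : (a : 𝓞 K) ∈ 𝔮 := by
    have h2 := sub_mem hA1 (𝔮.mem_of_dvd ha hl)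
    rwa [sub_sub_cancel] at h2
  obtain ⟨s, t, hst⟩ := (Nat.prime_iff_prime_int.1 hp).coprime_iff_not_dvd.2 hpa
  refine h𝔮.ne_top ((Ideal.eq_top_iff_one _).2 ?_)
  have h1 : ((s * q + t * a : ℤ) : 𝓞 K) ∈ 𝔮 := by
    push_cast
    exact add_mem (Ideal.mul_mem_left _ _ hq𝔮) (Ideal.mul_mem_left _ _ ha1)
  rwa [hst, Int.cast_one] at h1

end Congruence

end SingularIntegers

open SingularIntegers in
theorem theoreml512164 {p : ℕ} [Fact p.Prime] (hp : Odd p)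
    {K : Type*} [Field K] [NumberField K] [IsCyclotomicExtension {p} ℚ K]
    {ζ : K} (hζ : IsPrimitiveRoot ζ p)
    (v : (ZMod p)ˣ) (hv : orderOf v = p - 1)
    (σ : K ≃ₐ[ℚ] K) (hσ : σ ζ = ζ ^ (v : ZMod p).val)
    (Γ : Subgroup (ClassGroup (𝓞 K))) (μ : (ZMod p)ˣ)
    (hΓ : SingularIntegers.IsEigenSubgroup p σ μ Γ)
    (n : ℕ) (hn₁ : 1 < n) (hn₂ : n ≤ p - 2) (hμ : μ = v ^ n)
    (𝔮 : (Ideal (𝓞 K))⁰) (h𝔮 : (𝔮 : Ideal (𝓞 K)).IsPrime) (h𝔮Γ : ClassGroup.mk0 𝔮 ∈ Γ)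
    (q : ℕ) (hq : q.Prime) (hq𝔮 : (q : 𝓞 K) ∈ (𝔮 : Ideal (𝓞 K)))
    (A : 𝓞 K) (hA : SingularIntegers.IsSingular p A)
    (hA𝔮 : Ideal.span {A} = (𝔮 : Ideal (𝓞 K)) ^ p)
    (hAn : ∃ a : ℤ, ¬ (p : ℤ) ∣ a ∧ (hζ.toInteger - 1) ^ n ∣ A - (a : 𝓞 K)) :
    (q ≡ 1 [MOD p] →
      ∃ δ : 𝓞 K, (δ = 1 ∨ δ = -1) ∧
        (hζ.toInteger - 1) ^ (2 * p - 1) ∣ SingularIntegers.powP p σ v A - δ) ∧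
    ((∃ δ : 𝓞 K, (δ = 1 ∨ δ = -1) ∧
        SingularIntegers.ExactlyDivides (hζ.toInteger - 1) (2 * p - 1)
          (SingularIntegers.powP p σ v A - δ)) ↔
      q ≡ 1 [MOD p] ∧ ¬ p ^ ((q - 1) / p) ≡ 1 [MOD q]) ∧
    (¬ q ≡ 1 [MOD p] →
      ∃ δ : 𝓞 K, (δ = 1 ∨ δ = -1) ∧
        (hζ.toInteger - 1) ^ (2 * p) ∣ SingularIntegers.powP p σ v A - δ) := by
  have hpp := (Fact.out : p.Prime)
  have hp2 : 2 < p := by have := hpp.two_le; omega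
  have : Fact q.Prime := ⟨hq⟩
  have hprime : Prime (hζ.toInteger - 1) := hζ.zeta_sub_one_prime'
  have h𝔮max : (𝔮 : Ideal (𝓞 K)).IsMaximal := h𝔮.isMaximal (nonZeroDivisors.ne_zero 𝔮.2)
  have hover := liesOver_span_of_mem hq𝔮
  obtain ⟨a, hpa, ha⟩ := hAn
  have ha2 : (hζ.toInteger - 1) ^ 2 ∣ A - (a : 𝓞 K) := (pow_dvd_pow _ hn₁).trans ha
  have hqp := coprime_of_span_eq_pow hζ hpa ((dvd_pow_self _ two_ne_zero).trans ha2) hq𝔮 hA𝔮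
  obtain ⟨E, hE⟩ : ∃ E, q ^ orderOf (q : ZMod p) - 1 = p * E := by
    have h1 : ((q ^ orderOf (q : ZMod p) : ℕ) : ZMod p) = ((1 : ℕ) : ZMod p) := by
      rw [Nat.cast_pow, pow_orderOf_eq_one, Nat.cast_one]
    rw [ZMod.natCast_eq_natCast_iff] at h1
    exact (Nat.modEq_iff_dvd' (Nat.one_le_pow _ _ hq.pos)).1 h1.symm
  have hE := hE.symm
  obtain ⟨w, y, hw1, hw2, hw0, hy, hyc, c, hc, hcE⟩ :=
    exists_stickelberger_element_of_isMaximal hp hζ (𝔮 : Ideal (𝓞 K)) hqp hE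
  have hyq : y ∣ (q : 𝓞 K) ^ (orderOf (q : ZMod p) * p) := by
    rw [Nat.cast_pow, ← pow_mul] at hyc
    exact Dvd.intro _ hyc
  obtain ⟨u, hu⟩ := associated_prod_pow (𝔮 : Ideal (𝓞 K)) hqp hA𝔮 w hw1 hw2 hw0 hy hyq
  rw [← absNorm_eq_pow_orderOf (𝔮 : Ideal (𝓞 K)) hqp] at hyc
  have h𝔮N : Ideal.absNorm (𝔮 : Ideal (𝓞 K)) ≠ 0 := by
    rw [absNorm_eq_pow_orderOf (𝔮 : Ideal (𝓞 K)) hqp]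
    exact pow_ne_zero _ hq.ne_zero
  obtain ⟨m, hm⟩ := exists_intCast_congr_prod hζ ha2
  have hyp := pow_prime_congr_of_congr hζ.toInteger_isPrimitiveRoot hp hc
  have hyp1 : (hζ.toInteger - 1) ^ (2 * p - 1) ∣ y ^ p + 1 := by
    have h1 := (pow_dvd_pow (hζ.toInteger - 1) (show 2 * p - 1 ≤ 2 * p by omega)).trans hyp
    exact (dvd_add_left (Dvd.intro_left _ rfl)).1 h1
  have hB := eq_or_eq_neg_of_congr hp hp2 hζ hu
    (norm_embedding_eq_one hA𝔮 h𝔮N hyc hu) hm ((pow_dvd_pow _ (by omega)).trans hyp1)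
  rw [← powP_eq hv (galEquivZMod_eq hζ hσ)] at hB
  set B := powP p σ v A
  have hyp2 : (hζ.toInteger - 1) ^ (2 * p) ∣ y ^ p + 1 ↔
      (q ≡ 1 [MOD p] → p ^ ((q - 1) / p) ≡ 1 [MOD q]) := by
    rw [← prime_pow_sub_one_mem_iff (𝔮 : Ideal (𝓞 K)) hq𝔮 hqp hE, ← hcE]
    have h1 : (hζ.toInteger - 1) ^ (2 * p) =
        (hζ.toInteger - 1) * (hζ.toInteger - 1) ^ (2 * p - 1) := by
      rw [← pow_succ']; congr 1; omega
    rw [← mul_dvd_mul_iff_right (a := hζ.toInteger - 1) (pow_ne_zero (2 * p - 1) hprime.ne_zero),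
      ← h1]
    constructor
    · intro h; exact (dvd_add_right h).1 hyp
    · intro h; exact (dvd_add_left h).1 hyp
  -- As `y ^ p ≡ -1`, the sign `δ` is the opposite of the one in `A ^ P(σ) = ± y ^ p`.
  obtain ⟨δ, hδ, hBδ⟩ : ∃ δ : 𝓞 K, (δ = 1 ∨ δ = -1) ∧
      ∀ d, d ∣ B - δ ↔ d ∣ y ^ p + 1 := by
    rcases hB with h | h
    · exact ⟨-1, Or.inr rfl, fun d ↦ by rw [h, sub_neg_eq_add]⟩
    · exact ⟨1, Or.inl rfl, fun d ↦ by rw [h, ← dvd_neg]; ring_nf⟩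
  have hle : (hζ.toInteger - 1) ^ (2 * p - 1) ∣ B - δ := (hBδ _).2 hyp1
  have h2p : 2 * p - 1 + 1 = 2 * p := by omega
  refine ⟨fun _ ↦ ⟨δ, hδ, hle⟩, ⟨?_, ?_⟩, fun h ↦ ⟨δ, hδ, (hBδ _).2 (hyp2.2 fun h1 ↦ absurd h1 h)⟩⟩
  · rintro ⟨δ', hδ', h1, h2⟩
    -- The sign is determined, because `ζ - 1` does not divide `2`.
    have hδδ : δ' = δ := by
      by_contra hne
      have h3 := dvd_sub h1 hle
      rw [sub_sub_sub_cancel_left] at h3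
      have h4 : hζ.toInteger - 1 ∣ ((2 : ℤ) : 𝓞 K) := by
        refine ((dvd_pow_self _ (by omega)).trans h3).trans ?_
        rcases hδ with rfl | rfl <;> rcases hδ' with rfl | rfl
        · exact absurd rfl hne
        · exact Dvd.intro 1 (by push_cast; ring)
        · exact Dvd.intro (-1) (by push_cast; ring)
        · exact absurd rfl hne
      have h5 := (IsCyclotomicExtension.Rat.zeta_sub_one_dvd_intCast_iff' p hζ).1 h4
      have h6 := Int.le_of_dvd two_pos h5
      omega
    rw [h2p, hδδ, hBδ, hyp2] at h2
    push Not at h2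
    exact h2
  · rintro ⟨h1, h2⟩
    refine ⟨δ, hδ, hle, ?_⟩
    rw [h2p, hBδ, hyp2]
    exact fun h ↦ h2 (h h1)
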